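/- Let $k,n\in\mathbb N$ (both $\ge 1$), $T\in(0,\infty)$, and let $E=E(\mathbb R^n)$ be a rearrangement-invariant Banach function space of complex-valued functions. Let $f^*$ denote the decreasing rearrangement of $f$. Let $\widetilde E(\mathbb R_+)$ be the Luxemburg representation of $E$ (so $\|f\|_E=\|f^*\|_{\widetilde E}$), let $$\|h\|_{\widetilde E'(\mathbb R_+)}=\sup\Big\{\int_0^\infty h^*f^*\,dt:\ \|f\|_{\widetilde E(\mathbb R_+)}\le 1\Big\},$$ and let $\widetilde E(0,T)$, $\widetilde E'(0,T)$ be the restrictions to $(0,T)$, that is, the norms of the extensions by zero. Let $\Phi:\mathbb R_+\to[0,\infty)$ be continuous and decreasing with $0<\int_0^\infty\Phi(z)z^{n-1}\,dz<\infty$, let $V_n$ be the volume of the unit ball of $\mathbb R^n$, and put $$\varphi(\tau)=\Phi\big((\tau/V_n)^{1/n}\big),\qquad \Omega_\varphi(t,\tau)=\frac{\varphi(\tau)}{1+(\tau/t)^{k/n}},\qquad c_0=1+\Big(\int_T^\infty\varphi\Big)\Big(\int_0^T\varphi\Big)^{-1},\qquad G(x)=\Phi(|x|).$$ Assume $\varphi\in\widetilde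 E'(0,T)$. Let $H^G_E=\{G*f:\ f\in E\}$ with $\|u\|_{H^G_E}=\inf\{\|f\|_E:\ f\in E,\ G*f=u\}$, let $\omega_k(u,s)=\sup_{|h|\le s}\sup_{x}|\Delta_h^ku(x)|$, and put $$\Omega^k_{EG}(t^{1/n})=\sup\{\omega_k(u,t^{1/n}):\ u\in H^G_E,\ \|u\|_{H^G_E}\le 1\}.$$ **Part 1.** Assume that $\Phi\in C^k(\mathbb R_+)$ and that, with $\Phi_j=\big(\tfrac1z\tfrac{d}{dz}\big)^j\Phi$ and some $a_1,a_2,z_1>0$, $$\max_{1\le j\le k}z^{2j}|\Phi_j(z)|\le a_1\Phi(z)\ \ (0<z\le z_1),\qquad \max_{1\le j\le k}z^{2j}|\Phi_j(z)|\le a_2z^k\Phi(z)\ \ (z>z_1).$$ Then, with a constant $c_1\in(0,\infty)$ depending only on $k,n,z_1,a_1,a_2,T,c_0$, $$\Omega^k_{EG}(t^{1/n})\le c_1\,\|\Omega_\varphi(t,\cdot)\|_{\widetilde E'(0,T)},\qquad t\in(0,T),$$ and with the same constant $$\omega_k(G*f,t^{1/n})\le c_1\int_0^T\Omega_\varphi(t,\tau)f^*(\tau)\,d\tau\qquad\text{for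 all } f\in E,\ t\in(0,T).$$ **Part 2.** Assume in addition that, for some $\delta_1>0$, $(-1)^kz^k\Phi^{(k)}(z)\ge\delta_1\Phi(z)$ for $0<z\le z_1$. Then the upper bound of Part 1 holds and, with a constant $c_2>0$ depending only on $k,n,z_1,a_1,\delta_1,T$, $$\Omega^k_{EG}(t^{1/n})\ge c_2\,\|\Omega_\varphi(t,\cdot)\|_{\widetilde E'(0,T)},\qquad t\in(0,T).$$ With the same $c_2$, for every nonnegative decreasing $\sigma\in\widetilde E(0,T)$ (extended by zero to $\mathbb R_+$) there is $f\in E$ with $f^*\le\sigma$ on $\mathbb R_+$ and $$\omega_k(G*f,t^{1/n})\ge c_2\int_0^T\Omega_\varphi(t,\tau)\sigma(\tau)\,d\tau\qquad\text{for all } t\in(0,T).$$ -/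

import Mathlib

open MeasureTheory Set
open scoped ENNReal NNReal

noncomputable section

/-- The decreasing rearrangement `f^*(t) = inf {s ≥ 0 : μ {f > s} ≤ t}` of a nonnegative function
`f` (for scalar functions it is applied to the absolute value). It is decreasing, right-continuous
and equimeasurable with `f`. Only its values at `t > 0` are used. -/
def rearr {α : Type*} [MeasurableSpace α] (μ : Measure α) (f : α → ℝ≥0∞) (t : ℝ) : ℝ≥0∞ :=
  sInf {s : ℝ≥0∞ | μ {x | s < f x} ≤ ENNReal.ofReal t}

/-- A rearrangement-invariant Banach function space, given by its norm on the nonnegative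
measurable functions, with the value `∞` exactly off the space: a measurable scalar function `f`
belongs to the space iff the norm of `|f|` is finite, and this is then the norm of `f`. -/
structure RISpace {α : Type*} [MeasurableSpace α] (μ : Measure α) where
  /-- the norm, extended by `∞` -/
  rho : (α → ℝ≥0∞) → ℝ≥0∞
  rho_smul : ∀ (c : ℝ≥0) (f : α → ℝ≥0∞), AEMeasurable f μ →
    rho (fun x => (c : ℝ≥0∞) * f x) = c * rho f
  rho_add : ∀ f g : α → ℝ≥0∞, AEMeasurable f μ → AEMeasurable g μ →
    rho (fun x => f x + g x) ≤ rho f + rho g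
  rho_eq_zero : ∀ f : α → ℝ≥0∞, AEMeasurable f μ → (rho f = 0 ↔ f =ᵐ[μ] 0)
  rho_mono : ∀ f g : α → ℝ≥0∞, AEMeasurable f μ → AEMeasurable g μ → f ≤ᵐ[μ] g → rho f ≤ rho g
  rho_iSup : ∀ f : ℕ → α → ℝ≥0∞, (∀ i, AEMeasurable (f i) μ) → Monotone f →
    rho (fun x => ⨆ i, f i x) = ⨆ i, rho (f i)
  lintegral_le : ∀ B : Set α, MeasurableSet B → μ B < ∞ →
    ∃ c : ℝ≥0, ∀ f : α → ℝ≥0∞, AEMeasurable f μ → ∫⁻ x in B, f x ∂μ ≤ c * rho f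
  rho_indicator : ∀ B : Set α, MeasurableSet B → μ B < ∞ → rho (B.indicator fun _ => 1) < ∞
  rho_rearr : ∀ f g : α → ℝ≥0∞, AEMeasurable f μ → AEMeasurable g μ →
    (∀ t : ℝ, 0 < t → rearr μ f t ≤ rearr μ g t) → rho f ≤ rho g

/-- Lebesgue measure on `ℝ₊ = (0, ∞)`. -/
def volPos : Measure ℝ := volume.restrict (Ioi 0)

/-- `V_n`, the volume of the unit ball of `ℝⁿ`. -/
def ballVol (n : ℕ) : ℝ := (volume (Metric.ball (0 : EuclideanSpace ℝ (Fin n)) 1)).toReal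

variable {n : ℕ}

/-- `f ∈ E(ℝⁿ)`, for a complex-valued `f`. -/
def RISpace.Mem (E : RISpace (volume : Measure (EuclideanSpace ℝ (Fin n))))
    (f : EuclideanSpace ℝ (Fin n) → ℂ) : Prop :=
  AEMeasurable f volume ∧ E.rho (fun x => ‖f x‖ₑ) < ∞

/-- The norm of the Luxemburg representation `Ẽ(ℝ₊)` of `E(ℝⁿ)`. It is computed through the radial
function `x ↦ h^*(V_n |x|^n)` on `ℝⁿ`, whose rearrangement is `h^*`; thus `‖f^*‖_Ẽ = ‖f‖_E`. -/
def RISpace.luxNorm (E : RISpace (volume : Measure (EuclideanSpace ℝ (Fin n))))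
    (h : ℝ → ℝ≥0∞) : ℝ≥0∞ :=
  E.rho (fun x => rearr volPos h (ballVol n * ‖x‖ ^ n))

/-- The norm of the associate space `Ẽ'(ℝ₊)`. -/
def RISpace.assocNorm (E : RISpace (volume : Measure (EuclideanSpace ℝ (Fin n))))
    (h : ℝ → ℝ≥0∞) : ℝ≥0∞ :=
  ⨆ (f : ℝ → ℝ≥0∞) (_ : AEMeasurable f volPos) (_ : E.luxNorm f ≤ 1),
    ∫⁻ t in Ioi (0 : ℝ), rearr volPos h t * rearr volPos f t

/-- The norm of `Ẽ(0,T)`: functions on `(0,T)` are extended by zero to `ℝ₊`. -/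
def RISpace.luxNormOn (E : RISpace (volume : Measure (EuclideanSpace ℝ (Fin n)))) (T : ℝ)
    (h : ℝ → ℝ≥0∞) : ℝ≥0∞ :=
  E.luxNorm ((Ioo 0 T).indicator h)

/-- The norm of `Ẽ'(0,T)`, the restriction of `Ẽ'(ℝ₊)` to `(0,T)`, at a nonnegative function. -/
def RISpace.assocNormOn (E : RISpace (volume : Measure (EuclideanSpace ℝ (Fin n)))) (T : ℝ)
    (h : ℝ → ℝ) : ℝ≥0∞ :=
  E.assocNorm ((Ioo 0 T).indicator fun τ => ENNReal.ofReal (h τ))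

/-- The standing assumptions on the profile `Φ : ℝ₊ → [0,∞)` of the kernel (the values of `Φ`
outside `(0,∞)` are irrelevant). -/
structure IsStandardProfile (n : ℕ) (Φ : ℝ → ℝ) : Prop where
  nonneg : ∀ z, 0 < z → 0 ≤ Φ z
  continuousOn : ContinuousOn Φ (Ioi 0)
  antitoneOn : AntitoneOn Φ (Ioi 0)
  integral_pos : 0 < ∫⁻ z in Ioi (0 : ℝ), ENNReal.ofReal (Φ z * z ^ (n - 1))
  integral_lt_top : ∫⁻ z in Ioi (0 : ℝ), ENNReal.ofReal (Φ z * z ^ (n - 1)) < ∞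

/-- `φ(τ) = Φ((τ/V_n)^{1/n})`. -/
def phi (n : ℕ) (Φ : ℝ → ℝ) (τ : ℝ) : ℝ := Φ ((τ / ballVol n) ^ (1 / (n : ℝ)))

/-- `Ω_φ(t,τ) = φ(τ) / (1 + (τ/t)^{k/n})`. -/
def OmegaPhi (n k : ℕ) (Φ : ℝ → ℝ) (t τ : ℝ) : ℝ :=
  phi n Φ τ / (1 + (τ / t) ^ ((k : ℝ) / (n : ℝ)))

/-- `c₀ = 1 + (∫_T^∞ φ) (∫_0^T φ)⁻¹`. -/
def tailConst (n : ℕ) (Φ : ℝ → ℝ) (T : ℝ) : ℝ :=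
  1 + (∫ τ in Ioi T, phi n Φ τ) / ∫ τ in Ioo 0 T, phi n Φ τ

/-- `Φ_j(z) = ((1/z) d/dz)^j Φ(z)`. -/
def radialDeriv (j : ℕ) (Φ : ℝ → ℝ) : ℝ → ℝ :=
  (fun (g : ℝ → ℝ) (z : ℝ) => z⁻¹ * deriv g z)^[j] Φ

/-- `Φ ∈ C^k(ℝ₊)` with `max_{1≤j≤k} z^{2j} |Φ_j(z)|` bounded by `a₁ Φ(z)` on `(0,z₁]` and by
`a₂ z^k Φ(z)` on `(z₁,∞)`. -/
structure DerivUpperBounds (k : ℕ) (Φ : ℝ → ℝ) (z₁ a₁ a₂ : ℝ) : Prop where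
  contDiffOn : ContDiffOn ℝ k Φ (Ioi 0)
  near : ∀ z ∈ Ioc 0 z₁, ∀ j ∈ Finset.Icc 1 k, z ^ (2 * j) * |radialDeriv j Φ z| ≤ a₁ * Φ z
  far : ∀ z ∈ Ioi z₁, ∀ j ∈ Finset.Icc 1 k,
    z ^ (2 * j) * |radialDeriv j Φ z| ≤ a₂ * z ^ k * Φ z

/-- `(-1)^k z^k Φ^{(k)}(z) ≥ δ₁ Φ(z)` on `(0,z₁]`. -/
def DerivLowerBound (k : ℕ) (Φ : ℝ → ℝ) (z₁ δ₁ : ℝ) : Prop :=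
  ∀ z ∈ Ioc 0 z₁, δ₁ * Φ z ≤ (-1) ^ k * z ^ k * iteratedDeriv k Φ z

/-- The potential `(G * f)(x) = ∫ G(x-y) f(y) dy` with the kernel `G(x) = Φ(|x|)`. -/
def potential (Φ : ℝ → ℝ) (f : EuclideanSpace ℝ (Fin n) → ℂ) :
    EuclideanSpace ℝ (Fin n) → ℂ :=
  fun x => ∫ y, (Φ ‖x - y‖ : ℂ) * f y

/-- The space of potentials `H_E^G = {G * f : f ∈ E}`. -/
def potentialSpace (E : RISpace (volume : Measure (EuclideanSpace ℝ (Fin n)))) (Φ : ℝ → ℝ) :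
    Set (EuclideanSpace ℝ (Fin n) → ℂ) :=
  {u | ∃ f, E.Mem f ∧ potential Φ f = u}

/-- The norm of `H_E^G`: the infimum of `‖f‖_E` over `f ∈ E` with `G * f = u`. -/
def potentialNorm (E : RISpace (volume : Measure (EuclideanSpace ℝ (Fin n)))) (Φ : ℝ → ℝ)
    (u : EuclideanSpace ℝ (Fin n) → ℂ) : ℝ≥0∞ :=
  ⨅ (f : EuclideanSpace ℝ (Fin n) → ℂ) (_ : E.Mem f) (_ : potential Φ f = u),
    E.rho (fun x => ‖f x‖ₑ)

/-- The modulus of smoothness `ω_k(u;s) = sup_{|h| ≤ s} sup_x |Δ_h^k u(x)|`. -/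
def modulus (k : ℕ) (u : EuclideanSpace ℝ (Fin n) → ℂ) (s : ℝ) : ℝ≥0∞ :=
  ⨆ (h : EuclideanSpace ℝ (Fin n)) (_ : ‖h‖ ≤ s) (x : EuclideanSpace ℝ (Fin n)),
    ‖(fwdDiff h)^[k] u x‖ₑ

/-- The uniform majorant `Ω^k_{EG}(s) = sup {ω_k(u;s) : u ∈ H_E^G, ‖u‖_{H_E^G} ≤ 1}`. -/
def uniformMajorant (k : ℕ) (E : RISpace (volume : Measure (EuclideanSpace ℝ (Fin n))))
    (Φ : ℝ → ℝ) (s : ℝ) : ℝ≥0∞ :=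
  ⨆ (u : EuclideanSpace ℝ (Fin n) → ℂ) (_ : u ∈ potentialSpace E Φ)
    (_ : potentialNorm E Φ u ≤ 1), modulus k u s

end

/-! ### Rearrangements, layer cakes and the Hardy–Littlewood inequality. -/

section Rearrangement

variable {α β : Type*} [MeasurableSpace α] [MeasurableSpace β] {μ : Measure α} {ν : Measure β}

/-! The `k`-th difference of `G * f` is the convolution of `f` with `Δ_h^k G`, so everything rests
on two-sided bounds for `Δ_h^k G` with `|h| ≤ s = t^{1/n}`.

Upper bound. If `|x| ≤ 2ks`, each of the `k + 1` terms of the difference is estimated separately,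
because there the weight of `Ω_φ` is bounded below. If `|x| > 2ks`, the mean value inequality and a
formula for the `k`-th directional derivative of `Φ(|x|)` through the `Φ_j` give a bound of order
`((s/|x|)^k + s^k) Φ(|x|/2)`. The term without decay in `|x|` is the reason why the weight is frozen
beyond `τ = T` (`cutKernel`). Together this is `exists_abs_fwdDiff_le_cutKernel`. Hardy–Littlewood
replaces `f` by `f^*`, and since `f^*` decreases, the part of the integral beyond `T` costs only the
factor `c₀`; this is `exists_modulus_le`. Hölder's inequality turns it into the bound by the
associate norm.

Lower bound. The sign condition concerns the radial derivative, but by continuity it survives, with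
half the constant, for directional derivatives along `e` at points of a narrow cone around `e`
(`le_radialPoly_of_cone`). A step along `e` does not leave the cone, so near the origin `(-1)^k
Δ_h^k G` is at least a multiple of `Ω_φ(t, V_n |y|^n)` on it (`exists_OmegaPhi_le_fwdDiff`). For
`f`, take `σ(V_n |y|^n)` cut off to the cone and to a small ball: nothing cancels in the difference
at the origin, and `y ↦ V_n |y|^n` carries Lebesgue measure on the cone to a multiple of Lebesgue
measure on `ℝ₊`. A dilation recovers all of `(0,T)` from the small ball (`exists_le_modulus`). This
`f` does not depend on `t`, and `f^* ≤ σ`; letting `σ` run through the rearrangements in the unit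
ball produces the associate norm. -/

theorem lt_rearr_iff (f : α → ℝ≥0∞) (t : ℝ) (s : ℝ≥0∞) :
    s < rearr μ f t ↔ ENNReal.ofReal t < μ {x | s < f x} := by
  constructor
  · intro h
    by_contra! hle
    exact absurd h (not_lt.2 (sInf_le hle))
  · intro h
    by_cases hs : s = ∞
    · simp [hs] at h
    -- The distribution function is continuous from the right: `{f > s}` is the increasing union of
    -- the `{f > u i}` with `u i ↓ s`.
    obtain ⟨u, hu, hus, hut⟩ := exists_seq_strictAnti_tendsto' (lt_top_iff_ne_top.2 hs)
    have hU : {x | s < f x} = ⋃ i, {x | u i < f x} := by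
      ext x
      simp only [mem_ofPred_eq, mem_iUnion]
      constructor
      · intro hx
        exact ((hut.eventually (gt_mem_nhds hx)).exists)
      · rintro ⟨i, hi⟩
        exact (hus i).1.trans hi
    have hmono : Monotone fun i => {x | u i < f x} := fun i j hij x hx =>
      lt_of_le_of_lt (hu.antitone hij) hx
    rw [hU, hmono.measure_iUnion, lt_iSup_iff] at h
    obtain ⟨i, hi⟩ := h
    refine (hus i).1.trans_le (le_sInf fun r hr => ?_)
    by_contra! hlt
    exact absurd (hi.trans_le ((measure_mono fun x hx => hlt.trans hx).trans hr)) (lt_irrefl _)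

theorem rearr_le_iff (f : α → ℝ≥0∞) (t : ℝ) (s : ℝ≥0∞) :
    rearr μ f t ≤ s ↔ μ {x | s < f x} ≤ ENNReal.ofReal t := by
  rw [← not_lt, lt_rearr_iff, not_lt]

theorem rearr_antitone (f : α → ℝ≥0∞) : Antitone (rearr μ f) := fun s t hst =>
  (rearr_le_iff f t _).2 (((rearr_le_iff f s _).1 le_rfl).trans (ENNReal.ofReal_le_ofReal hst))

/-- Only distribution functions enter, so functions on different measure spaces can be compared. -/
theorem rearr_mono_of_meas {f : α → ℝ≥0∞} {g : β → ℝ≥0∞}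
    (h : ∀ s, μ {x | s < f x} ≤ ν {x | s < g x}) (t : ℝ) : rearr μ f t ≤ rearr ν g t :=
  (rearr_le_iff f t _).2 ((h _).trans ((rearr_le_iff g t _).1 le_rfl))

theorem rearr_mono_ae {f g : α → ℝ≥0∞} (h : f ≤ᵐ[μ] g) (t : ℝ) : rearr μ f t ≤ rearr μ g t :=
  rearr_mono_of_meas (fun _ => measure_mono_ae (h.mono fun _ hx hs => lt_of_lt_of_le hs hx)) t

theorem rearr_congr_ae {f g : α → ℝ≥0∞} (h : f =ᵐ[μ] g) : rearr μ f = rearr μ g :=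
  funext fun t => le_antisymm (rearr_mono_ae h.le t) (rearr_mono_ae h.symm.le t)

theorem rearr_comp {p : α → β} (hp : MeasurePreserving p μ ν) {f : β → ℝ≥0∞}
    (hf : AEMeasurable f ν) : rearr μ (fun x => f (p x)) = rearr ν f := by
  have key : ∀ s, μ {x | s < f (p x)} = ν {y | s < f y} := fun s =>
    hp.measure_preimage (nullMeasurableSet_lt aemeasurable_const hf)
  exact funext fun t => le_antisymm (rearr_mono_of_meas (fun s => (key s).le) t)
    (rearr_mono_of_meas (fun s => (key s).ge) t)

theorem rearr_const_mul {f : α → ℝ≥0∞} {c : ℝ≥0∞} (hc : c ≠ 0) (hc' : c ≠ ∞) (t : ℝ) :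
    rearr μ (fun x => c * f x) t = c * rearr μ f t := by
  refine eq_of_forall_lt_iff fun s => ?_
  have key : ∀ x : ℝ≥0∞, s < c * x ↔ s / c < x := fun x => by
    rw [ENNReal.div_lt_iff (Or.inl hc) (Or.inl hc'), mul_comm]
  rw [lt_rearr_iff, key, lt_rearr_iff]
  simp only [key]

theorem volPos_setOf_ofReal_lt (x : ℝ≥0∞) : volPos {t | ENNReal.ofReal t < x} = x := by
  rw [volPos, Measure.restrict_apply (measurableSet_lt (by fun_prop) measurable_const)]
  by_cases hx : x = ∞
  · simp [hx]
  · have : {t | ENNReal.ofReal t < x} ∩ Ioi 0 = Ioo 0 x.toReal := by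
      ext t
      simp only [mem_inter_iff, mem_ofPred_eq, mem_Ioi, mem_Ioo]
      rw [and_comm]
      exact and_congr_right fun ht => ENNReal.ofReal_lt_iff_lt_toReal ht.le hx
    rw [this, Real.volume_Ioo, sub_zero, ENNReal.ofReal_toReal hx]

/-- Equimeasurability: by `lt_rearr_iff` the superlevel set of `f^*` in `ℝ₊` is an interval starting
at `0`, of length `μ {f > s}`. -/
theorem volPos_lt_rearr (f : α → ℝ≥0∞) (s : ℝ≥0∞) :
    volPos {t | s < rearr μ f t} = μ {x | s < f x} := by
  simp only [lt_rearr_iff, volPos_setOf_ofReal_lt]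

theorem rearr_volPos_rearr (f : α → ℝ≥0∞) : rearr volPos (rearr μ f) = rearr μ f :=
  funext fun t => le_antisymm (rearr_mono_of_meas (fun s => (volPos_lt_rearr f s).le) t)
    (rearr_mono_of_meas (fun s => (volPos_lt_rearr f s).ge) t)

/-- Layer cake in both factors: `f x * g x` is the area of a rectangle, and Tonelli exchanges the
integrals. -/
theorem lintegral_mul_eq_lintegral_meas [SFinite μ] {f g : α → ℝ≥0∞} (hf : Measurable f)
    (hg : Measurable g) : ∫⁻ x, f x * g x ∂μ = ∫⁻ s, ∫⁻ t,
      μ {x | ENNReal.ofReal s < f x ∧ ENNReal.ofReal t < g x} ∂volPos ∂volPos := by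
  have : SFinite volPos := by unfold volPos; infer_instance
  have hind : Measurable fun q : α × ℝ × ℝ =>
      {q : α × ℝ × ℝ | ENNReal.ofReal q.2.1 < f q.1 ∧ ENNReal.ofReal q.2.2 < g q.1}.indicator
        (fun _ => (1 : ℝ≥0∞)) q := by
    have h1 : MeasurableSet {q : α × ℝ × ℝ | ENNReal.ofReal q.2.1 < f q.1} :=
      measurableSet_lt (by fun_prop) (by fun_prop)
    have h2 : MeasurableSet {q : α × ℝ × ℝ | ENNReal.ofReal q.2.2 < g q.1} :=
      measurableSet_lt (by fun_prop) (by fun_prop)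
    exact measurable_const.indicator (h1.inter h2)
  have h1 : ∀ x, f x * g x = ∫⁻ q : ℝ × ℝ,
      {q : α × ℝ × ℝ | ENNReal.ofReal q.2.1 < f q.1 ∧ ENNReal.ofReal q.2.2 < g q.1}.indicator
        (fun _ => (1 : ℝ≥0∞)) (x, q) ∂(volPos.prod volPos) := fun x => by
    have : (fun q : ℝ × ℝ =>
      {q : α × ℝ × ℝ | ENNReal.ofReal q.2.1 < f q.1 ∧ ENNReal.ofReal q.2.2 < g q.1}.indicator
        (fun _ => (1 : ℝ≥0∞)) (x, q)) =
        ({t | ENNReal.ofReal t < f x} ×ˢ {t | ENNReal.ofReal t < g x}).indicator 1 := by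
      ext q; simp [indicator, mem_prod]
    rw [this, lintegral_indicator_one, Measure.prod_prod, volPos_setOf_ofReal_lt,
      volPos_setOf_ofReal_lt]
    exact (measurableSet_lt (by fun_prop) measurable_const).prod
      (measurableSet_lt (by fun_prop) measurable_const)
  simp_rw [h1]
  rw [lintegral_lintegral_swap hind.aemeasurable, lintegral_prod]
  · refine lintegral_congr fun s => lintegral_congr fun t => ?_
    rw [← lintegral_indicator_one]
    · simp [indicator]
    · exact (measurableSet_lt measurable_const hf).inter (measurableSet_lt measurable_const hg)
  · exact (Measurable.lintegral_prod_left' (μ := μ) hind).aemeasurable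

/-- The Hardy–Littlewood rearrangement inequality. -/
theorem lintegral_mul_le_lintegral_rearr [SFinite μ] {f g : α → ℝ≥0∞} (hf : AEMeasurable f μ)
    (hg : AEMeasurable g μ) :
    ∫⁻ x, f x * g x ∂μ ≤ ∫⁻ t in Ioi (0 : ℝ), rearr μ f t * rearr μ g t := by
  rw [rearr_congr_ae hf.ae_eq_mk, rearr_congr_ae hg.ae_eq_mk,
    lintegral_congr_ae (f := fun x => f x * g x) (hf.ae_eq_mk.mul hg.ae_eq_mk)]
  have : SFinite volPos := by unfold volPos; infer_instance
  change _ ≤ ∫⁻ t, _ ∂volPos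
  simp only [Pi.mul_apply]
  rw [lintegral_mul_eq_lintegral_meas hf.measurable_mk hg.measurable_mk,
    lintegral_mul_eq_lintegral_meas (rearr_antitone _).measurable (rearr_antitone _).measurable]
  refine lintegral_mono fun s => lintegral_mono fun t => ?_
  -- Superlevel sets of rearrangements are nested intervals, so their intersection has the smaller
  -- of the two measures, the most that any intersection can have.
  simp only [lt_rearr_iff, ← lt_min_iff, volPos_setOf_ofReal_lt]
  exact le_min (measure_mono fun x hx => hx.1)
    (measure_mono fun x hx => hx.2)

theorem aemeasurable_volPos_of_antitoneOn {ψ : ℝ → ℝ≥0∞} (h : AntitoneOn ψ (Ioi 0)) :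
    AEMeasurable ψ volPos :=
  aemeasurable_restrict_of_antitoneOn measurableSet_Ioi h

theorem rearr_volPos_le {ψ : ℝ → ℝ≥0∞} (h : AntitoneOn ψ (Ioi 0)) {t : ℝ} (ht : 0 < t) :
    rearr volPos ψ t ≤ ψ t := by
  rw [rearr_le_iff]
  have hsub : {x | ψ t < ψ x} ∩ Ioi 0 ⊆ Ioo 0 t := fun x ⟨hx, hx0⟩ =>
    ⟨hx0, by
      by_contra! hle
      exact absurd (h ht hx0 hle) (not_le.2 hx)⟩
  rw [volPos, Measure.restrict_apply' measurableSet_Ioi]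
  refine (measure_mono hsub).trans ?_
  simp

/-- The counterpart of `rearr_volPos_le`. At a jump `ψ` need not be right-continuous while its
rearrangement is, which forces `u > t`. -/
theorem le_rearr_volPos {ψ : ℝ → ℝ≥0∞} (h : AntitoneOn ψ (Ioi 0)) {t u : ℝ} (ht : 0 < t)
    (hu : t < u) : ψ u ≤ rearr volPos ψ t := by
  by_contra! hlt
  have hsub : Ioc 0 u ⊆ {x | rearr volPos ψ t < ψ x} ∩ Ioi 0 := fun x hx =>
    ⟨hlt.trans_le (h hx.1 (ht.trans hu) hx.2), hx.1⟩
  have h2 := (rearr_le_iff (μ := volPos) ψ t _).1 le_rfl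
  rw [volPos, Measure.restrict_apply' measurableSet_Ioi] at h2
  have h3 := (measure_mono (μ := volume) hsub).trans h2
  rw [Real.volume_Ioc, sub_zero, ENNReal.ofReal_le_ofReal_iff ht.le] at h3
  linarith

/-- Applied with `p y = V_n |x - y|^n`: it replaces a radial kernel centred anywhere by an integral
against `f^*`. -/
theorem lintegral_antitone_comp_mul_le [SFinite μ] {p : α → ℝ} (hp : MeasurePreserving p μ volPos)
    {ψ : ℝ → ℝ≥0∞} (hψ : AntitoneOn ψ (Ioi 0)) {f : α → ℝ≥0∞} (hf : AEMeasurable f μ) :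
    ∫⁻ x, ψ (p x) * f x ∂μ ≤ ∫⁻ t in Ioi (0 : ℝ), ψ t * rearr μ f t := by
  have hm := aemeasurable_volPos_of_antitoneOn hψ
  refine (lintegral_mul_le_lintegral_rearr
    (hm.comp_quasiMeasurePreserving hp.quasiMeasurePreserving) hf).trans ?_
  refine setLIntegral_mono_ae' measurableSet_Ioi (Filter.Eventually.of_forall fun t ht => ?_)
  change rearr μ (fun x => ψ (p x)) t * _ ≤ _
  rw [rearr_comp hp hm]
  gcongr
  exact rearr_volPos_le hψ ht

/-- Dilating one factor of a product costs at most the dilation factor if the other factor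
decreases. -/
theorem lintegral_comp_div_mul_le {ψ χ : ℝ → ℝ≥0∞} (hχ : AntitoneOn χ (Ioi 0)) {l : ℝ}
    (hl : 1 ≤ l) : ∫⁻ t in Ioi (0 : ℝ), ψ (t / l) * χ t ≤
      ENNReal.ofReal l * ∫⁻ t in Ioi (0 : ℝ), ψ t * χ t := by
  have hl0 : 0 < l := by linarith
  have himg : (fun t => l * t) '' Ioi 0 = Ioi 0 := by
    rw [image_mul_left_Ioi hl0, mul_zero]
  have hcv := lintegral_image_eq_lintegral_abs_deriv_mul (measurableSet_Ioi (a := (0 : ℝ)))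
    (f := fun t => l * t) (f' := fun _ => l)
    (fun x _ => by simpa using ((hasDerivAt_id x).const_mul l).hasDerivWithinAt)
    (fun x _ y _ hxy => by simpa [hl0.ne'] using hxy) (fun t => ψ (t / l) * χ t)
  rw [himg] at hcv
  rw [hcv, ← lintegral_const_mul' _ _ ENNReal.ofReal_ne_top]
  refine setLIntegral_mono_ae' measurableSet_Ioi (Filter.Eventually.of_forall fun t ht => ?_)
  rw [abs_of_pos hl0, mul_div_cancel_left₀ _ hl0.ne']
  gcongr
  exact hχ ht (mul_pos hl0 ht) (le_mul_of_one_le_left (le_of_lt ht) hl)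

end Rearrangement

/-! ### The measure-preserving map `x ↦ V_n |x|^n`. -/

section RadialPush

open scoped Pointwise

variable {n : ℕ}

theorem ballVol_pos (n : ℕ) : 0 < ballVol n :=
  ENNReal.toReal_pos (Metric.measure_ball_pos _ _ one_pos).ne' measure_ball_lt_top.ne

theorem volume_closedBall_one_eq :
    volume (Metric.closedBall (0 : EuclideanSpace ℝ (Fin n)) 1) = ENNReal.ofReal (ballVol n) := by
  rw [ballVol, ENNReal.ofReal_toReal measure_ball_lt_top.ne,
    Measure.addHaar_unitClosedBall_eq_addHaar_unitBall]

/-- The volume of the ball of radius `‖x‖`. -/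
noncomputable def radialVol (x : EuclideanSpace ℝ (Fin n)) : ℝ := ballVol n * ‖x‖ ^ n

theorem measurable_radialVol : Measurable (radialVol (n := n)) := by
  unfold radialVol; fun_prop

theorem radialVol_nonneg (x : EuclideanSpace ℝ (Fin n)) : 0 ≤ radialVol x :=
  mul_nonneg (ballVol_pos n).le (by positivity)

theorem radialVol_pos {x : EuclideanSpace ℝ (Fin n)} (hx : x ≠ 0) : 0 < radialVol x :=
  mul_pos (ballVol_pos n) (pow_pos (norm_pos_iff.2 hx) _)

/-- The image of Lebesgue measure on a cone under `radialVol`. -/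
theorem map_radialVol_restrict_cone (hn : 1 ≤ n) {C : Set (EuclideanSpace ℝ (Fin n))}
    (hcone : ∀ r : ℝ, 0 < r → ∀ x, r • x ∈ C ↔ x ∈ C) :
    Measure.map radialVol (volume.restrict C) =
      (volume (C ∩ Metric.closedBall 0 1) / ENNReal.ofReal (ballVol n)) • volPos := by
  have hV := ballVol_pos n
  have hn0 : n ≠ 0 := by omega
  have hIic : ∀ a : ℝ, Measure.map radialVol (volume.restrict C) (Iic a) =
      ((volume (C ∩ Metric.closedBall 0 1) / ENNReal.ofReal (ballVol n)) • volPos) (Iic a) := by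
    intro a
    rw [Measure.map_apply measurable_radialVol measurableSet_Iic,
      Measure.restrict_apply (measurable_radialVol measurableSet_Iic), Measure.smul_apply,
      volPos, Measure.restrict_apply measurableSet_Iic, Iic_inter_Ioi, Real.volume_Ioc, sub_zero,
      smul_eq_mul]
    rcases le_or_gt a 0 with ha | ha
    -- For `a ≤ 0` the preimage contains at most the origin.
    · have : NeZero n := ⟨hn0⟩
      rw [ENNReal.ofReal_of_nonpos ha, mul_zero]
      refine measure_mono_null (t := {0}) (fun x hx => ?_) (measure_singleton 0)
      by_contra hx0
      have h1 : radialVol x ≤ a := hx.1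
      linarith [radialVol_pos (x := x) hx0]
    · set r := (a / ballVol n) ^ (1 / (n : ℝ)) with hr
      have hr0 : 0 < r := Real.rpow_pos_of_pos (div_pos ha hV) _
      have hrn : r ^ n = a / ballVol n := by
        rw [hr, one_div, Real.rpow_inv_natCast_pow (div_pos ha hV).le hn0]
      -- A cone is invariant under dilations, so its sublevel sets are dilates of one another and
      -- their volume is proportional to `r ^ n`.
      have hset : radialVol ⁻¹' Iic a ∩ C = r • (C ∩ Metric.closedBall 0 1) := by
        ext x
        rw [mem_smul_set_iff_inv_smul_mem₀ hr0.ne']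
        simp only [mem_inter_iff, mem_preimage, mem_Iic, Metric.mem_closedBall, dist_zero_right]
        rw [hcone _ (inv_pos.2 hr0), and_comm, norm_smul, norm_inv, Real.norm_of_nonneg hr0.le,
          inv_mul_le_iff₀ hr0, mul_one, ← pow_le_pow_iff_left₀ (norm_nonneg x) hr0.le hn0, hrn,
          le_div_iff₀ hV, mul_comm]
        rfl
      rw [hset, Measure.addHaar_smul, finrank_euclideanSpace_fin, hrn, abs_of_pos (div_pos ha hV),
        ENNReal.ofReal_div_of_pos hV]
      simp only [ENNReal.div_eq_inv_mul]
      ring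
  have hfin : ∀ a : ℝ, ((volume (C ∩ Metric.closedBall 0 1) / ENNReal.ofReal (ballVol n)) •
      volPos) (Iic a) < ∞ := fun a => by
    rw [Measure.smul_apply, volPos, Measure.restrict_apply measurableSet_Iic, Iic_inter_Ioi,
      Real.volume_Ioc]
    refine ENNReal.mul_lt_top (ENNReal.div_lt_top ?_ (ENNReal.ofReal_pos.2 hV).ne')
      ENNReal.ofReal_lt_top
    exact ((measure_mono inter_subset_right).trans_lt
      (isCompact_closedBall _ _).measure_lt_top).ne
  refine Measure.ext_of_Ioc' _ _ (fun a b _ => ?_) (fun a b hab => ?_)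
  · exact ((measure_mono Ioc_subset_Iic_self).trans_lt (by rw [hIic]; exact hfin b)).ne
  · have hIoc : Ioc a b = Iic b \ Iic a := by ext x; simp [and_comm]
    rw [hIoc, measure_sdiff (Iic_subset_Iic.2 hab.le) measurableSet_Iic.nullMeasurableSet
      (by rw [hIic]; exact (hfin a).ne), measure_sdiff (Iic_subset_Iic.2 hab.le)
      measurableSet_Iic.nullMeasurableSet (hfin a).ne, hIic, hIic]

theorem measurePreserving_radialVol (hn : 1 ≤ n) :
    MeasurePreserving (radialVol (n := n)) volume volPos := by
  refine ⟨measurable_radialVol, ?_⟩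
  have := map_radialVol_restrict_cone hn (C := univ) (by simp)
  rw [Measure.restrict_univ, univ_inter, volume_closedBall_one_eq,
    ENNReal.div_self (ENNReal.ofReal_pos.2 (ballVol_pos n)).ne' ENNReal.ofReal_ne_top,
    one_smul] at this
  exact this

theorem measurePreserving_radialVol_sub (hn : 1 ≤ n) (c : EuclideanSpace ℝ (Fin n)) :
    MeasurePreserving (fun y => radialVol (c - y)) volume volPos :=
  (measurePreserving_radialVol hn).comp (Measure.measurePreserving_sub_left volume c)

/-- `φ(V_n |x|^n) = Φ(|x|)`. -/
theorem phi_radialVol (hn : 1 ≤ n) (Φ : ℝ → ℝ) (x : EuclideanSpace ℝ (Fin n)) :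
    phi n Φ (radialVol x) = Φ ‖x‖ := by
  rw [phi, radialVol, mul_div_cancel_left₀ _ (ballVol_pos n).ne', one_div,
    Real.pow_rpow_inv_natCast (norm_nonneg x) (by omega)]

end RadialPush

/-! ### The Luxemburg representation and the associate norm. -/

section Norms

variable {n : ℕ} {E : RISpace (volume : Measure (EuclideanSpace ℝ (Fin n)))}

theorem aemeasurable_rearr_radialVol {α : Type*} [MeasurableSpace α] {μ : Measure α}
    (h : α → ℝ≥0∞) (p : EuclideanSpace ℝ (Fin n) → ℝ) (hp : Measurable p) :
    AEMeasurable (fun x => rearr μ h (p x)) volume :=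
  ((rearr_antitone h).measurable.comp hp).aemeasurable

/-- This justifies the definition of `luxNorm`: the radial function used there is equimeasurable
with `h`. -/
theorem rearr_luxembourg (hn : 1 ≤ n) (h : ℝ → ℝ≥0∞) :
    rearr (volume : Measure (EuclideanSpace ℝ (Fin n)))
      (fun x => rearr volPos h (ballVol n * ‖x‖ ^ n)) = rearr volPos h := by
  have := rearr_comp (measurePreserving_radialVol hn)
    (rearr_antitone (μ := volPos) h).measurable.aemeasurable
  exact this.trans (rearr_volPos_rearr h)

theorem rho_le_luxNorm (hn : 1 ≤ n) {f : EuclideanSpace ℝ (Fin n) → ℝ≥0∞}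
    (hf : AEMeasurable f volume) {h : ℝ → ℝ≥0∞}
    (hle : ∀ t, 0 < t → rearr volume f t ≤ rearr volPos h t) : E.rho f ≤ E.luxNorm h := by
  refine E.rho_rearr _ _ hf (aemeasurable_rearr_radialVol h _ measurable_radialVol) fun t ht => ?_
  rw [rearr_luxembourg hn]
  exact hle t ht

theorem luxNorm_mono {g h : ℝ → ℝ≥0∞} (hle : ∀ t, 0 < t → rearr volPos g t ≤ rearr volPos h t)
    (hn : 1 ≤ n) : E.luxNorm g ≤ E.luxNorm h :=
  rho_le_luxNorm hn (aemeasurable_rearr_radialVol g _ measurable_radialVol)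
    (fun t ht => (congrFun (rearr_luxembourg hn g) t).trans_le (hle t ht))

theorem luxNorm_rearr_le (hn : 1 ≤ n) {f : EuclideanSpace ℝ (Fin n) → ℝ≥0∞}
    (hf : AEMeasurable f volume) : E.luxNorm (rearr volume f) ≤ E.rho f := by
  refine E.rho_rearr _ _ (aemeasurable_rearr_radialVol _ _ measurable_radialVol) hf fun t _ => ?_
  rw [rearr_luxembourg hn, rearr_volPos_rearr]

theorem luxNorm_const_mul (c : ℝ≥0) (hc : c ≠ 0) (h : ℝ → ℝ≥0∞) :
    E.luxNorm (fun t => (c : ℝ≥0∞) * h t) = c * E.luxNorm h := by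
  unfold RISpace.luxNorm
  simp only [rearr_const_mul (ENNReal.coe_ne_zero.2 hc) ENNReal.coe_ne_top]
  exact E.rho_smul c _ (aemeasurable_rearr_radialVol h _ measurable_radialVol)

/-- Hölder's inequality for the associate norm. -/
theorem lintegral_rearr_mul_rearr_le {f h : ℝ → ℝ≥0∞} (hf : AEMeasurable f volPos) {N : ℝ≥0}
    (hN : N ≠ 0) (hfN : E.luxNorm f ≤ N) :
    ∫⁻ t in Ioi (0 : ℝ), rearr volPos h t * rearr volPos f t ≤ N * E.assocNorm h := by
  -- Rescale `f` into the unit ball. Dividing by a nonzero finite bound instead of the norm itself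
  -- also covers norm zero.
  have hNi : N⁻¹ ≠ 0 := inv_ne_zero hN
  have h1 : ∫⁻ t in Ioi (0 : ℝ), rearr volPos h t *
      rearr volPos (fun t => ((N⁻¹ : ℝ≥0) : ℝ≥0∞) * f t) t ≤ E.assocNorm h := by
    unfold RISpace.assocNorm
    refine le_iSup_of_le _ (le_iSup_of_le (hf.const_mul _) (le_iSup_of_le ?_ le_rfl))
    rw [luxNorm_const_mul _ hNi]
    calc ((N⁻¹ : ℝ≥0) : ℝ≥0∞) * E.luxNorm f ≤ ((N⁻¹ : ℝ≥0) : ℝ≥0∞) * N := by gcongr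
      _ = 1 := by rw [← ENNReal.coe_mul, inv_mul_cancel₀ hN, ENNReal.coe_one]
  calc ∫⁻ t in Ioi (0 : ℝ), rearr volPos h t * rearr volPos f t
      = N * ∫⁻ t in Ioi (0 : ℝ), rearr volPos h t *
        rearr volPos (fun t => ((N⁻¹ : ℝ≥0) : ℝ≥0∞) * f t) t := by
        rw [← lintegral_const_mul' _ _ ENNReal.coe_ne_top]
        refine lintegral_congr fun t => ?_
        rw [rearr_const_mul (ENNReal.coe_ne_zero.2 hNi) ENNReal.coe_ne_top, mul_left_comm,
          ← mul_assoc (N : ℝ≥0∞), ← ENNReal.coe_mul, mul_inv_cancel₀ hN, ENNReal.coe_one, one_mul]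
    _ ≤ _ := by gcongr

theorem antitoneOn_indicator_Ioo {T : ℝ} {σ : ℝ → ℝ≥0∞} (hσ : AntitoneOn σ (Ioo 0 T)) :
    AntitoneOn ((Ioo 0 T).indicator σ) (Ioi 0) := by
  intro x hx y hy hxy
  by_cases hyT : y < T
  · rw [indicator_of_mem (show y ∈ Ioo 0 T from ⟨hy, hyT⟩),
      indicator_of_mem (show x ∈ Ioo 0 T from ⟨hx, hxy.trans_lt hyT⟩)]
    exact hσ ⟨hx, hxy.trans_lt hyT⟩ ⟨hy, hyT⟩ hxy
  · rw [indicator_of_notMem (show y ∉ Ioo 0 T from fun h => hyT h.2)]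
    exact zero_le

theorem rearr_volPos_indicator_eq {T : ℝ} {ψ : ℝ → ℝ}
    (hψ : AntitoneOn ψ (Ioo 0 T)) (hc : ContinuousOn ψ (Ioo 0 T)) {t : ℝ} (ht : 0 < t) :
    rearr volPos ((Ioo 0 T).indicator fun τ => ENNReal.ofReal (ψ τ)) t =
      (Ioo 0 T).indicator (fun τ => ENNReal.ofReal (ψ τ)) t := by
  have hanti := antitoneOn_indicator_Ioo (σ := fun τ => ENNReal.ofReal (ψ τ))
    fun x hx y hy hxy => ENNReal.ofReal_le_ofReal (hψ hx hy hxy)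
  refine le_antisymm (rearr_volPos_le hanti ht) ?_
  by_cases htT : t ∈ Ioo 0 T
  · rw [indicator_of_mem htT]
    have hnhds : Ioo 0 T ∈ nhds t := Ioo_mem_nhds htT.1 htT.2
    -- Let `u ↓ t` in `le_rearr_volPos`; continuity of `ψ` excludes a jump.
    have hlim : Filter.Tendsto (fun τ => ENNReal.ofReal (ψ τ)) (nhdsWithin t (Ioi t))
        (nhds (ENNReal.ofReal (ψ t))) :=
      ((ENNReal.continuous_ofReal.tendsto _).comp (hc.continuousAt hnhds)).mono_left
        nhdsWithin_le_nhds
    refine le_of_tendsto hlim ?_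
    filter_upwards [self_mem_nhdsWithin, nhdsWithin_le_nhds hnhds] with u hu huT
    have := le_rearr_volPos hanti ht hu
    rwa [indicator_of_mem huT] at this
  · rw [indicator_of_notMem htT]
    exact zero_le

end Norms

/-! ### Iterated differences estimated by derivatives. -/

section DerivChain

/-- `g 0, …, g k` is a chain of successive derivatives on `[a, b]`. -/
def DerivChain (k : ℕ) (g : ℕ → ℝ → ℝ) (a b : ℝ) : Prop :=
  ∀ m < k, ∀ x ∈ Icc a b, HasDerivAt (g m) (g (m + 1) x) x

/-- The induction step for iterated differences: one difference uses up a length `r` at the right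
end, and the top derivative is left for the mean value inequality in `mul_le_fwdDiff`. -/
theorem DerivChain.fwdDiff {k : ℕ} {g : ℕ → ℝ → ℝ} {a b : ℝ} (hg : DerivChain (k + 1) g a b)
    {r : ℝ} (hr : 0 ≤ r) : DerivChain k (fun m => fwdDiff r (g m)) a (b - r) := by
  intro m hm x hx
  have h1 := hg m (by omega) x ⟨hx.1, by linarith [hx.2]⟩
  have h2 := hg m (by omega) (x + r) ⟨by linarith [hx.1], by linarith [hx.2]⟩
  exact (h2.comp_add_const x r).sub h1

theorem DerivChain.mul_le_fwdDiff {k : ℕ} {g : ℕ → ℝ → ℝ} {a b : ℝ}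
    (hg : DerivChain (k + 1) g a b) {r c : ℝ} (hr : 0 ≤ r)
    (hc : ∀ x ∈ Icc a b, c ≤ g (k + 1) x) :
    ∀ x ∈ Icc a (b - r), c * r ≤ _root_.fwdDiff r (g k) x := by
  intro x hx
  have hsub : Icc x (x + r) ⊆ Icc a b := Icc_subset_Icc hx.1 (by linarith [hx.2])
  have := (convex_Icc x (x + r)).mul_sub_le_image_sub_of_le_deriv (f := g k) (C := c)
    (fun y hy => (hg k (by omega) y (hsub hy)).continuousAt.continuousWithinAt)
    (fun y hy =>
      (hg k (by omega) y (hsub (interior_subset hy))).differentiableAt.differentiableWithinAt)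
    (fun y hy => by
      rw [(hg k (by omega) y (hsub (interior_subset hy))).deriv]
      exact hc y (hsub (interior_subset hy)))
    x (left_mem_Icc.2 (by linarith)) (x + r) (right_mem_Icc.2 (by linarith)) (by linarith)
  rw [_root_.fwdDiff]
  linarith

/-- A lower bound for the `k`-th derivative bounds the `k`-th difference from below. -/
theorem DerivChain.le_iterate_fwdDiff {k : ℕ} {g : ℕ → ℝ → ℝ} {a b c r : ℝ}
    (hg : DerivChain k g a b) (hr : 0 ≤ r) (hab : a + k * r ≤ b)
    (hc : ∀ x ∈ Icc a b, c ≤ g k x) : c * r ^ k ≤ (_root_.fwdDiff r)^[k] (g 0) a := by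
  induction k generalizing g b c with
  | zero => simpa using hc a ⟨le_rfl, by simpa using hab⟩
  | succ k ih =>
    rw [Function.iterate_succ_apply, pow_succ', ← mul_assoc]
    push_cast at hab
    exact ih (hg.fwdDiff hr) (by linarith) (hg.mul_le_fwdDiff hr hc)

theorem DerivChain.mono {k : ℕ} {g : ℕ → ℝ → ℝ} {a b a' b' : ℝ} (hg : DerivChain k g a b)
    (ha : a ≤ a') (hb : b' ≤ b) : DerivChain k g a' b' :=
  fun m hm x hx => hg m hm x ⟨ha.trans hx.1, hx.2.trans hb⟩

theorem fwdDiff_iterate_comm (r s : ℝ) (k : ℕ) (f : ℝ → ℝ) :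
    (fwdDiff r)^[k] (fwdDiff s f) = fwdDiff s ((fwdDiff r)^[k] f) := by
  have : Function.Commute (fwdDiff r : (ℝ → ℝ) → ℝ → ℝ) (fwdDiff s) := fun f => by
    funext x
    simp only [fwdDiff, add_right_comm x r s]
    ring
  exact (this.iterate_left k) f

/-- If the `k`-th derivative is nonnegative, then the `k`-th difference increases with the step. -/
theorem DerivChain.iterate_fwdDiff_mono {k : ℕ} {g : ℕ → ℝ → ℝ} {a b r s : ℝ}
    (hg : DerivChain k g a b) (hr : 0 ≤ r) (hrs : r ≤ s) (hab : a + k * s ≤ b)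
    (hc : ∀ x ∈ Icc a b, 0 ≤ g k x) :
    (_root_.fwdDiff r)^[k] (g 0) a ≤ (_root_.fwdDiff s)^[k] (g 0) a := by
  induction k generalizing g b with
  | zero => simp
  | succ k ih =>
    have hs : 0 ≤ s := hr.trans hrs
    push_cast at hab
    rw [Function.iterate_succ_apply, Function.iterate_succ_apply]
    have h1 := ih (hg.fwdDiff hs) (by linarith)
      (fun x hx => by simpa using hg.mul_le_fwdDiff hs hc x hx)
    refine le_trans ?_ h1
    -- With `H = Δ_r^k g₀` it remains to see `H (a + r) ≤ H (a + s)`. The increment is the `k`-th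
    -- `r`-difference of `Δ_{s-r} g₀` at `a + r`, which is nonnegative because the `k`-th derivative
    -- of `Δ_{s-r} g₀` is.
    rw [fwdDiff_iterate_comm, fwdDiff_iterate_comm]
    have hd : 0 ≤ s - r := by linarith
    have hks : (k : ℝ) * r ≤ k * s := by gcongr
    have h2 := ((hg.fwdDiff hd).mono (a' := a + r) (by linarith) le_rfl).le_iterate_fwdDiff
      (c := 0) hr (by linarith)
      (fun x hx => by
        simpa using hg.mul_le_fwdDiff hd hc x ⟨by linarith [hx.1], hx.2⟩)
    rw [zero_mul, fwdDiff_iterate_comm] at h2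
    simp only [_root_.fwdDiff] at h2 ⊢
    rw [show a + r + (s - r) = a + s by ring] at h2
    linarith

theorem DerivChain.const_mul {k : ℕ} {g : ℕ → ℝ → ℝ} {a b : ℝ} (hg : DerivChain k g a b) (c : ℝ) :
    DerivChain k (fun m x => c * g m x) a b :=
  fun m hm x hx => (hg m hm x hx).const_mul c

theorem fwdDiff_iterate_const_mul (c r : ℝ) (k : ℕ) (f : ℝ → ℝ) (x : ℝ) :
    (fwdDiff r)^[k] (fun y => c * f y) x = c * (fwdDiff r)^[k] f x := by
  have := fwdDiff_iter_const_smul r c f k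
  exact congrFun this x

theorem DerivChain.abs_iterate_fwdDiff_le {k : ℕ} {g : ℕ → ℝ → ℝ} {a b c r : ℝ}
    (hg : DerivChain k g a b) (hr : 0 ≤ r) (hab : a + k * r ≤ b)
    (hc : ∀ x ∈ Icc a b, |g k x| ≤ c) : |(_root_.fwdDiff r)^[k] (g 0) a| ≤ c * r ^ k := by
  rw [abs_le]
  constructor
  · have := hg.le_iterate_fwdDiff hr hab (c := -c) fun x hx => (abs_le.1 (hc x hx)).1
    linarith
  · have := (hg.const_mul (-1)).le_iterate_fwdDiff hr hab (c := -c)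
      fun x hx => by linarith [(abs_le.1 (hc x hx)).2]
    simp only [fwdDiff_iterate_const_mul] at this
    linarith

end DerivChain

/-! ### Derivatives of `Φ(|z + θh|)` along a line. -/

section RadialDeriv

/-- The coefficients of the `m`-th derivative of `θ ↦ Φ(|z + θ h|)`. -/
def radialCoeff : ℕ → ℕ → ℕ
  | 0, 0 => 1
  | 0, _ + 1 => 0
  | _ + 1, 0 => 0
  -- Differentiating `Φ_j(r) p^{2j-m} q^{m-j}` with `r' = p/r`, `p' = q` raises `j` by one, or
  -- lowers the power of `p` and brings down `2j - m`. Truncated subtraction is harmless, since the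
  -- coefficient vanishes when `2j < m`.
  | m + 1, j + 1 => radialCoeff m j + (2 * (j + 1) - m) * radialCoeff m (j + 1)

theorem radialCoeff_eq_zero_of_lt {m j : ℕ} (h : m < j) : radialCoeff m j = 0 := by
  induction m generalizing j with
  | zero => cases j with
    | zero => omega
    | succ j => rfl
  | succ m ih => cases j with
    | zero => rfl
    | succ j => rw [radialCoeff, ih (by omega), ih (by omega), mul_zero, add_zero]

theorem radialCoeff_eq_zero_of_two_mul_lt {m j : ℕ} (h : 2 * j < m) : radialCoeff m j = 0 := by
  induction m generalizing j with
  | zero => omega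
  | succ m ih => cases j with
    | zero => rfl
    | succ j =>
      rw [radialCoeff, ih (by omega)]
      rcases Nat.lt_or_ge (2 * (j + 1)) m with h1 | h1
      · rw [ih h1, mul_zero, add_zero]
      · rw [show 2 * (j + 1) - m = 0 by omega, zero_mul, add_zero]

/-- The `m`-th derivative of `θ ↦ Φ(|z + θ h|)` in terms of `|w|`, `⟨w, h⟩` and `|h|²`, where
`w = z + θ h`. -/
noncomputable def radialPoly (Φ : ℝ → ℝ) (m : ℕ) (r p q : ℝ) : ℝ :=
  ∑ j ∈ Finset.range (m + 1),
    (radialCoeff m j : ℝ) * (radialDeriv j Φ r * (p ^ (2 * j - m) * q ^ (m - j)))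

theorem radialDeriv_succ (j : ℕ) (Φ : ℝ → ℝ) (z : ℝ) :
    radialDeriv (j + 1) Φ z = z⁻¹ * deriv (radialDeriv j Φ) z := by
  rw [radialDeriv, Function.iterate_succ_apply']
  rfl

theorem contDiffOn_radialDeriv {k : ℕ} {Φ : ℝ → ℝ} (hΦ : ContDiffOn ℝ k Φ (Ioi 0)) {j : ℕ}
    (hj : j ≤ k) : ContDiffOn ℝ ((k - j : ℕ) : ℕ∞) (radialDeriv j Φ) (Ioi 0) := by
  induction j with
  | zero => simpa [radialDeriv] using hΦ
  | succ j ih =>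
    have h1 := ih (by omega)
    have h2 : ContDiffOn ℝ ((k - (j + 1) : ℕ) : ℕ∞) (deriv (radialDeriv j Φ)) (Ioi 0) := by
      refine h1.deriv_of_isOpen isOpen_Ioi ?_
      norm_cast
      omega
    have h3 : ContDiffOn ℝ ((k - (j + 1) : ℕ) : ℕ∞) (fun z : ℝ => z⁻¹) (Ioi 0) :=
      contDiffOn_id.inv fun z hz => (ne_of_gt hz)
    exact (h3.mul h2).congr fun z _ => radialDeriv_succ j Φ z

theorem hasDerivAt_radialDeriv {k : ℕ} {Φ : ℝ → ℝ} (hΦ : ContDiffOn ℝ k Φ (Ioi 0)) {j : ℕ}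
    (hj : j < k) {z : ℝ} (hz : 0 < z) :
    HasDerivAt (radialDeriv j Φ) (z * radialDeriv (j + 1) Φ z) z := by
  rw [radialDeriv_succ, mul_inv_cancel_left₀ hz.ne']
  have h1 := contDiffOn_radialDeriv hΦ hj.le
  have h2 : (1 : WithTop ℕ∞) ≤ ((k - j : ℕ) : ℕ∞) := by
    norm_cast
    omega
  exact ((h1.differentiableOn (by positivity)).differentiableAt (Ioi_mem_nhds hz)).hasDerivAt

/-- One more derivative along a curve with `r' = p / r`, `p' = q`. -/
theorem hasDerivAt_radialPoly {k : ℕ} {Φ : ℝ → ℝ} (hΦ : ContDiffOn ℝ k Φ (Ioi 0)) {m : ℕ}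
    (hm : m < k) {r p : ℝ → ℝ} {q x : ℝ} (hr0 : 0 < r x) (hr : HasDerivAt r (p x / r x) x)
    (hp : HasDerivAt p q x) :
    HasDerivAt (fun y => radialPoly Φ m (r y) (p y) q)
      (radialPoly Φ (m + 1) (r x) (p x) q) x := by
  have hterm : ∀ j ∈ Finset.range (m + 1), HasDerivAt
      (fun y => (radialCoeff m j : ℝ) * (radialDeriv j Φ (r y) * (p y ^ (2 * j - m) * q ^ (m - j))))
      ((radialCoeff m j : ℝ) * (radialDeriv (j + 1) Φ (r x) *
          (p x ^ (2 * (j + 1) - (m + 1)) * q ^ (m + 1 - (j + 1)))) +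
        ((2 * j - m : ℕ) * radialCoeff m j : ℝ) * (radialDeriv j Φ (r x) *
          (p x ^ (2 * j - (m + 1)) * q ^ (m + 1 - j)))) x := by
    intro j hj
    have hj' := Finset.mem_range.1 hj
    have h1 := (hasDerivAt_radialDeriv hΦ (show j < k by omega) hr0).comp x hr
    have h2 := ((hp.pow (2 * j - m)).mul_const (q ^ (m - j)))
    have h3 := (h1.mul h2).const_mul (radialCoeff m j : ℝ)
    refine h3.congr_deriv ?_
    rcases Nat.lt_or_ge (2 * j) m with h | h
    · simp [radialCoeff_eq_zero_of_two_mul_lt h]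
    · rw [show 2 * (j + 1) - (m + 1) = 2 * j - m + 1 by omega,
        show m + 1 - (j + 1) = m - j by omega, show 2 * j - (m + 1) = 2 * j - m - 1 by omega,
        show m + 1 - j = m - j + 1 by omega]
      simp only [Function.comp, Pi.pow_apply]
      field_simp
      ring
  refine (HasDerivAt.fun_sum hterm).congr_deriv ?_
  -- Shifting the index in the terms with `Φ_{j+1}` matches the recurrence of `radialCoeff`; the
  -- boundary terms have coefficient zero.
  rw [Finset.sum_add_distrib, radialPoly, Finset.sum_range_succ' _ (m + 1)]
  have h0 : (radialCoeff (m + 1) 0 : ℝ) = 0 := by simp [radialCoeff]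
  rw [h0, zero_mul, add_zero]
  simp only [radialCoeff, Nat.cast_add, Nat.cast_mul, add_mul, Finset.sum_add_distrib]
  congr 1
  rw [Finset.sum_range_succ' _ m, Finset.sum_range_succ _ m]
  have h1 : ((2 * 0 - m : ℕ) : ℝ) = 0 := by simp
  rw [h1, radialCoeff_eq_zero_of_lt (show m < m + 1 by omega)]
  simp

theorem radialPoly_zero (Φ : ℝ → ℝ) (r p q : ℝ) : radialPoly Φ 0 r p q = Φ r := by
  simp [radialPoly, radialCoeff, radialDeriv]

/-- Motion along a ray at unit speed has `r = p` and `q = 1`. This connects `DerivLowerBound` with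
the functions `Φ_j`. -/
theorem iteratedDeriv_eq_radialPoly {k : ℕ} {Φ : ℝ → ℝ} (hΦ : ContDiffOn ℝ k Φ (Ioi 0)) {m : ℕ}
    (hm : m ≤ k) {z : ℝ} (hz : 0 < z) : iteratedDeriv m Φ z = radialPoly Φ m z z 1 := by
  induction m generalizing z with
  | zero => rw [iteratedDeriv_zero, radialPoly_zero]
  | succ m ih =>
    rw [iteratedDeriv_succ]
    have h1 : iteratedDeriv m Φ =ᶠ[nhds z] fun y => radialPoly Φ m y y 1 := by
      filter_upwards [Ioi_mem_nhds hz] with y hy using ih (by omega) hy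
    rw [h1.deriv_eq]
    exact (hasDerivAt_radialPoly hΦ (by omega) hz
      ((hasDerivAt_id z).congr_deriv (by rw [id, div_self hz.ne'])) (hasDerivAt_id z)).deriv

variable {F : Type*} [NormedAddCommGroup F] [InnerProductSpace ℝ F]

theorem derivChain_radialPoly {k : ℕ} {Φ : ℝ → ℝ} (hΦ : ContDiffOn ℝ k Φ (Ioi 0)) {z h : F}
    {a b : ℝ} (hne : ∀ x ∈ Icc a b, z + x • h ≠ 0) :
    DerivChain k (fun m x => radialPoly Φ m ‖z + x • h‖ (inner ℝ (z + x • h) h) (‖h‖ ^ 2)) a b := by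
  intro m hm x hx
  have hw : HasDerivAt (fun y : ℝ => z + y • h) h x := by
    simpa using ((hasDerivAt_id x).smul_const h).const_add z
  have hpos : 0 < ‖z + x • h‖ := norm_pos_iff.2 (hne x hx)
  refine hasDerivAt_radialPoly (r := fun y => ‖z + y • h‖)
    (p := fun y => inner ℝ (z + y • h) h) hΦ hm hpos ?_ ?_
  · have h1 := hw.norm_sq.sqrt (by positivity)
    simp only [Real.sqrt_sq (norm_nonneg _)] at h1
    refine h1.congr_deriv ?_
    field_simp
  · have := hw.inner ℝ (hasDerivAt_const x h)
    simpa [real_inner_self_eq_norm_sq] using this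

end RadialDeriv

/-! ### Differences of the kernel far from the origin. -/

section UpperPointwise

/-- The sum of the coefficients of the `k`-th radial derivative. -/
def radialCoeffSum (k : ℕ) : ℝ := ∑ j ∈ Finset.range (k + 1), (radialCoeff k j : ℝ)

theorem radialCoeffSum_nonneg (k : ℕ) : 0 ≤ radialCoeffSum k :=
  Finset.sum_nonneg fun _ _ => Nat.cast_nonneg _

/-- All terms have the same homogeneity: for `|p| ≤ r b` the powers combine to `r^{2j} (b/r)^k`.
Terms with nonzero coefficient have `2j ≥ k ≥ 1`, so `Φ_0` does not occur. -/
theorem abs_radialPoly_le {k : ℕ} (hk : 1 ≤ k) {Φ : ℝ → ℝ} {r p b A : ℝ} (hr : 0 < r)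
    (hp : |p| ≤ r * b) (hA : ∀ j ∈ Finset.Icc 1 k, r ^ (2 * j) * |radialDeriv j Φ r| ≤ A) :
    |radialPoly Φ k r p (b ^ 2)| ≤ radialCoeffSum k * (A * (b / r) ^ k) := by
  have hb : 0 ≤ b := nonneg_of_mul_nonneg_right ((abs_nonneg p).trans hp) hr
  rw [radialPoly, radialCoeffSum, Finset.sum_mul]
  refine (Finset.abs_sum_le_sum_abs _ _).trans (Finset.sum_le_sum fun j hj => ?_)
  rw [abs_mul, Nat.abs_cast]
  rcases Nat.lt_or_ge (2 * j) k with h | h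
  · simp [radialCoeff_eq_zero_of_two_mul_lt h]
  have hj1 : 1 ≤ j := by omega
  have hjk : j ≤ k := by have := Finset.mem_range.1 hj; omega
  gcongr
  calc |radialDeriv j Φ r * (p ^ (2 * j - k) * (b ^ 2) ^ (k - j))|
      = |radialDeriv j Φ r| * (|p| ^ (2 * j - k) * (b ^ 2) ^ (k - j)) := by
        rw [abs_mul, abs_mul, abs_pow, abs_of_nonneg (show 0 ≤ (b ^ 2) ^ (k - j) by positivity)]
    _ ≤ |radialDeriv j Φ r| * ((r * b) ^ (2 * j - k) * (b ^ 2) ^ (k - j)) := by gcongr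
    _ = (r ^ (2 * j) * |radialDeriv j Φ r|) * (b / r) ^ k := by
        have h1 : r ^ (2 * j) = r ^ (2 * j - k) * r ^ k := by rw [← pow_add]; congr 1; omega
        have h2 : b ^ k = b ^ (2 * j - k) * (b ^ 2) ^ (k - j) := by
          rw [← pow_mul, ← pow_add]; congr 1; omega
        rw [div_pow, h1, mul_pow, h2]
        field_simp
    _ ≤ A * (b / r) ^ k := by
        gcongr
        exact hA j (Finset.mem_Icc.2 ⟨hj1, hjk⟩)

theorem iterate_fwdDiff_smul {F : Type*} [AddCommGroup F] [Module ℝ F] (k : ℕ) (G : F → ℝ)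
    (z e : F) (v : ℝ) :
    (fwdDiff (v • e))^[k] G z = (fwdDiff v)^[k] (fun θ : ℝ => G (z + θ • e)) 0 := by
  rw [fwdDiff_iter_eq_sum_shift, fwdDiff_iter_eq_sum_shift]
  refine Finset.sum_congr rfl fun j _ => ?_
  rw [zero_add, smul_assoc]

variable {F : Type*} [NormedAddCommGroup F] [InnerProductSpace ℝ F]

/-- The segment from `z` to `z + kh` stays at distance at least `‖z‖ / 2` from the origin, so the
`k`-th derivative can be bounded along it. The two summands come from the regimes `r ≤ z₁` and `r >
z₁`; in the second the factor `r^k` cancels the decay. -/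
theorem abs_fwdDiff_radial_le {k : ℕ} (hk : 1 ≤ k) {Φ : ℝ → ℝ} {z₁ a₁ a₂ : ℝ}
    (h₁ : 0 < a₁) (h₂ : 0 < a₂) (hΦ : DerivUpperBounds k Φ z₁ a₁ a₂)
    (hnn : ∀ z, 0 < z → 0 ≤ Φ z) (hanti : AntitoneOn Φ (Ioi 0)) {z h : F} (hz : z ≠ 0)
    (hzh : 2 * k * ‖h‖ ≤ ‖z‖) :
    |(fwdDiff h)^[k] (fun y => Φ ‖y‖) z| ≤
      radialCoeffSum k * ((a₁ * (2 / ‖z‖) ^ k + a₂) * ‖h‖ ^ k * Φ (‖z‖ / 2)) := by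
  have hz0 : 0 < ‖z‖ := norm_pos_iff.2 hz
  have hw : ∀ x ∈ Icc (0 : ℝ) k, ‖z‖ / 2 ≤ ‖z + x • h‖ := by
    intro x hx
    have h1 : ‖z‖ - ‖x • h‖ ≤ ‖z + x • h‖ := by
      simpa using norm_sub_norm_le z (-(x • h))
    have h2 : ‖x • h‖ ≤ k * ‖h‖ := by
      rw [norm_smul, Real.norm_of_nonneg hx.1]
      gcongr
      exact hx.2
    linarith
  have hne : ∀ x ∈ Icc (0 : ℝ) k, z + x • h ≠ 0 := fun x hx => by
    rw [← norm_pos_iff]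
    linarith [hw x hx]
  have hd := (derivChain_radialPoly hΦ.contDiffOn hne).abs_iterate_fwdDiff_le (r := 1)
    (c := radialCoeffSum k * ((a₁ * (2 / ‖z‖) ^ k + a₂) * ‖h‖ ^ k * Φ (‖z‖ / 2)))
    zero_le_one (by simp) ?_
  · have h0 := iterate_fwdDiff_smul k (fun y : F => Φ ‖y‖) z h 1
    rw [one_smul] at h0
    rw [h0]
    simpa [radialPoly_zero] using hd
  intro x hx
  set r := ‖z + x • h‖ with hrdef
  have hr2 : ‖z‖ / 2 ≤ r := hw x hx
  have hr : 0 < r := by linarith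
  have hΦr : Φ r ≤ Φ (‖z‖ / 2) := hanti (half_pos hz0) hr hr2
  have hΦ0 := hnn r hr
  have hinv : (‖h‖ / r) ^ k ≤ (2 / ‖z‖) ^ k * ‖h‖ ^ k := by
    rw [← mul_pow]
    gcongr
    rw [div_mul_eq_mul_div, div_le_div_iff₀ hr hz0]
    nlinarith [norm_nonneg h]
  have hΦz := hnn _ (half_pos hz0)
  have hK := radialCoeffSum_nonneg k
  rcases le_or_gt r z₁ with hrz | hrz
  · refine (abs_radialPoly_le hk hr (abs_real_inner_le_norm _ _)
      (fun j hj => hΦ.near r ⟨hr, hrz⟩ j hj)).trans (mul_le_mul_of_nonneg_left ?_ hK)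
    calc a₁ * Φ r * (‖h‖ / r) ^ k ≤ a₁ * Φ (‖z‖ / 2) * ((2 / ‖z‖) ^ k * ‖h‖ ^ k) := by gcongr
      _ ≤ a₁ * Φ (‖z‖ / 2) * ((2 / ‖z‖) ^ k * ‖h‖ ^ k) + a₂ * ‖h‖ ^ k * Φ (‖z‖ / 2) := by
        have : 0 ≤ a₂ * ‖h‖ ^ k * Φ (‖z‖ / 2) := by positivity
        linarith
      _ = _ := by ring
  · refine (abs_radialPoly_le hk hr (abs_real_inner_le_norm _ _)
      (fun j hj => hΦ.far r hrz j hj)).trans (mul_le_mul_of_nonneg_left ?_ hK)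
    calc a₂ * r ^ k * Φ r * (‖h‖ / r) ^ k = a₂ * ‖h‖ ^ k * Φ r := by
          rw [div_pow]
          field_simp
      _ ≤ a₂ * ‖h‖ ^ k * Φ (‖z‖ / 2) := by gcongr
      _ ≤ a₁ * Φ (‖z‖ / 2) * ((2 / ‖z‖) ^ k * ‖h‖ ^ k) + a₂ * ‖h‖ ^ k * Φ (‖z‖ / 2) := by
        have : 0 ≤ a₁ * Φ (‖z‖ / 2) * ((2 / ‖z‖) ^ k * ‖h‖ ^ k) := by positivity
        linarith
      _ = _ := by ring

end UpperPointwise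

/-! ### The pointwise upper bound by the truncated kernel. -/

section Weight

theorem mul_pow_rpow_div {n : ℕ} (hn : 1 ≤ n) (k : ℕ) {c r : ℝ} (hc : 0 ≤ c) (hr : 0 ≤ r) :
    (c * r ^ n) ^ ((k : ℝ) / n) = c ^ ((k : ℝ) / n) * r ^ k := by
  have hn0 : (n : ℝ) ≠ 0 := by positivity
  rw [Real.mul_rpow hc (by positivity), ← Real.rpow_natCast r n, ← Real.rpow_mul hr,
    mul_div_cancel₀ _ hn0, Real.rpow_natCast]

theorem rpow_one_div_pow {n : ℕ} (hn : 1 ≤ n) {t : ℝ} (ht : 0 ≤ t) :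
    (t ^ (1 / (n : ℝ))) ^ n = t := by
  rw [one_div, Real.rpow_inv_natCast_pow ht (by omega)]

/-- The kernel `φ(τ) / (1 + (min(τ,T)/t)^{k/n})`, which agrees with `Ω_φ(t,·)` up to `T` and is a
multiple of `φ` from there on. -/
noncomputable def cutKernel (n k : ℕ) (Φ : ℝ → ℝ) (T t τ : ℝ) : ℝ :=
  phi n Φ τ / (1 + (min τ T / t) ^ ((k : ℝ) / (n : ℝ)))

/-- The weight of the kernel at the radius `‖y‖`, in terms of `s = t^{1/n}`. -/
theorem radialVol_div_rpow {n : ℕ} (hn : 1 ≤ n) (k : ℕ) (y : EuclideanSpace ℝ (Fin n)) {t : ℝ}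
    (ht : 0 < t) : (radialVol y / t) ^ ((k : ℝ) / n) =
      ballVol n ^ ((k : ℝ) / n) * (‖y‖ / t ^ (1 / (n : ℝ))) ^ k := by
  have hs : 0 < t ^ (1 / (n : ℝ)) := Real.rpow_pos_of_pos ht _
  rw [← mul_pow_rpow_div hn k (ballVol_pos n).le (by positivity), div_pow,
    rpow_one_div_pow hn ht.le, radialVol, mul_div_assoc]

/-- The absolute values on the right are needed because a point `x + jh` may be the origin, where
the sign of `Φ` is not prescribed. -/
theorem exists_abs_fwdDiff_le_cutKernel (k n : ℕ) (hk : 1 ≤ k) (hn : 1 ≤ n) {a₁ a₂ T : ℝ}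
    (h₁ : 0 < a₁) (h₂ : 0 < a₂) (hT : 0 < T) : ∃ C : ℝ, 0 < C ∧ ∀ (z₁ : ℝ) (Φ : ℝ → ℝ),
      DerivUpperBounds k Φ z₁ a₁ a₂ → (∀ z, 0 < z → 0 ≤ Φ z) → AntitoneOn Φ (Ioi 0) →
      ∀ t ∈ Ioo 0 T, ∀ h : EuclideanSpace ℝ (Fin n), ‖h‖ ≤ t ^ (1 / (n : ℝ)) → ∀ x,
        |(fwdDiff h)^[k] (fun y => Φ ‖y‖) x| ≤
          C * ((∑ j ∈ Finset.range (k + 1), |cutKernel n k Φ T t (radialVol (x + j • h))|) +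
            |cutKernel n k Φ T t (radialVol ((1 / 2 : ℝ) • x))|) := by
  have hV := ballVol_pos n
  set v := ballVol n ^ ((k : ℝ) / n) with hv
  have hv0 : 0 < v := Real.rpow_pos_of_pos hV _
  have hTp : 0 < T ^ ((k : ℝ) / n) := Real.rpow_pos_of_pos hT _
  have hK := radialCoeffSum_nonneg k
  -- `C₁` serves `‖x‖ ≤ 2ks`: binomial coefficients are at most `2^k`, and all `‖x + jh‖ ≤ 3ks`.
  -- `C₂` serves the remaining `x`.
  set C₁ := (2 : ℝ) ^ k * (1 + v * (3 * k) ^ k) with hC₁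
  set C₂ := radialCoeffSum k * (a₁ * (1 + v) + 2 * a₂ * T ^ ((k : ℝ) / n)) with hC₂
  have hC₁0 : 0 < C₁ := by positivity
  have hC₂0 : 0 ≤ C₂ := by positivity
  refine ⟨C₁ + C₂, by positivity, fun z₁ Φ hΦ hnn hanti t ht h hh x => ?_⟩
  set s := t ^ (1 / (n : ℝ)) with hs
  have hs0 : 0 < s := Real.rpow_pos_of_pos ht.1 _
  have hk1 : (1 : ℝ) ≤ k := by exact_mod_cast hk
  have hkn : 0 ≤ (k : ℝ) / n := by positivity
  have hcut : ∀ y : EuclideanSpace ℝ (Fin n), cutKernel n k Φ T t (radialVol y) =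
      Φ ‖y‖ / (1 + (min (radialVol y) T / t) ^ ((k : ℝ) / n)) := fun y => by
    rw [cutKernel, phi_radialVol hn]
  have hden : ∀ y : EuclideanSpace ℝ (Fin n),
      0 < 1 + (min (radialVol y) T / t) ^ ((k : ℝ) / n) := fun y => by
    have : 0 ≤ min (radialVol y) T / t :=
      div_nonneg (le_min (radialVol_nonneg y) hT.le) ht.1.le
    positivity
  have hmin1 : ∀ y : EuclideanSpace ℝ (Fin n),
      (min (radialVol y) T / t) ^ ((k : ℝ) / n) ≤ v * (‖y‖ / s) ^ k := fun y => by
    rw [hv, ← radialVol_div_rpow hn k y ht.1]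
    have h0 := le_min (radialVol_nonneg y) hT.le
    have := ht.1
    gcongr
    exact min_le_left _ _
  have hmin2 : ∀ y : EuclideanSpace ℝ (Fin n),
      (min (radialVol y) T / t) ^ ((k : ℝ) / n) * s ^ k ≤ T ^ ((k : ℝ) / n) := fun y => by
    have h0 := le_min (radialVol_nonneg y) hT.le
    have ht0 := ht.1
    rw [← mul_pow_rpow_div hn k (div_nonneg h0 ht.1.le) hs0.le, hs, rpow_one_div_pow hn ht.1.le,
      div_mul_cancel₀ _ ht.1.ne']
    gcongr
    exact min_le_right _ _
  set S := ∑ j ∈ Finset.range (k + 1), |cutKernel n k Φ T t (radialVol (x + j • h))| with hS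
  have hS0 : 0 ≤ S := Finset.sum_nonneg fun _ _ => abs_nonneg _
  set B := |cutKernel n k Φ T t (radialVol ((1 / 2 : ℝ) • x))| with hB
  have hB0 : 0 ≤ B := abs_nonneg _
  rcases le_or_gt ‖x‖ (2 * k * s) with hx | hx
  · suffices |(fwdDiff h)^[k] (fun y => Φ ‖y‖) x| ≤ C₁ * S by
      nlinarith [mul_nonneg hC₁0.le hB0, mul_nonneg hC₂0 hS0, mul_nonneg hC₂0 hB0]
    rw [fwdDiff_iter_eq_sum_shift, hS, Finset.mul_sum]
    refine (Finset.abs_sum_le_sum_abs _ _).trans (Finset.sum_le_sum fun j hj => ?_)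
    have hjk : (j : ℝ) ≤ k := by
      have := Finset.mem_range.1 hj
      exact_mod_cast (by omega : j ≤ k)
    have hy : ‖x + j • h‖ / s ≤ 3 * k := by
      rw [div_le_iff₀ hs0]
      have h3 : ‖j • h‖ ≤ k * s := by
        rw [← Nat.cast_smul_eq_nsmul ℝ, norm_smul, Real.norm_of_nonneg (Nat.cast_nonneg j)]
        gcongr
      linarith [norm_add_le x (j • h)]
    have hchoose : ((k.choose j : ℕ) : ℝ) ≤ 2 ^ k := by exact_mod_cast Nat.choose_le_two_pow k j
    have habs : |((-1 : ℤ) ^ (k - j) * (k.choose j : ℤ)) • Φ ‖x + j • h‖| =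
        (k.choose j : ℝ) * |Φ ‖x + j • h‖| := by
      rw [zsmul_eq_mul, abs_mul]
      push_cast
      rw [abs_mul, abs_pow, abs_neg, abs_one, one_pow, one_mul, Nat.abs_cast]
    rw [habs, hcut, abs_div, abs_of_pos (hden _), hC₁, mul_assoc]
    gcongr
    rw [← mul_div_assoc, le_div_iff₀ (hden _), mul_comm]
    gcongr
    refine (hmin1 _).trans ?_
    gcongr
  · suffices |(fwdDiff h)^[k] (fun y => Φ ‖y‖) x| ≤ C₂ * B by
      nlinarith [mul_nonneg hC₁0.le hB0, mul_nonneg hC₁0.le hS0, mul_nonneg hC₂0 hS0]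
    have hx0 : 0 < ‖x‖ := lt_of_le_of_lt (by positivity) hx
    have hnorm : ‖(1 / 2 : ℝ) • x‖ = ‖x‖ / 2 := by
      rw [norm_smul]
      norm_num
      ring
    have hΦ0 := hnn _ (half_pos hx0)
    have hzh : 2 * k * ‖h‖ ≤ ‖x‖ := le_trans (by gcongr) hx.le
    refine (abs_fwdDiff_radial_le hk h₁ h₂ hΦ hnn hanti (norm_pos_iff.1 hx0) hzh).trans ?_
    rw [hB, hC₂, hcut, hnorm, abs_of_nonneg (div_nonneg hΦ0 (hden _).le),
      mul_assoc (radialCoeffSum k)]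
    refine mul_le_mul_of_nonneg_left ?_ hK
    rw [← mul_div_assoc, le_div_iff₀ (hden _)]
    set D := (min (radialVol ((1 / 2 : ℝ) • x)) T / t) ^ ((k : ℝ) / n) with hD
    have hD0 : 0 ≤ D :=
      Real.rpow_nonneg (div_nonneg (le_min (radialVol_nonneg _) hT.le) ht.1.le) _
    have hD1 : D ≤ v * (‖x‖ / 2 / s) ^ k := by
      have := hmin1 ((1 / 2 : ℝ) • x)
      rwa [hnorm] at this
    -- The truncation at `T` matters here: the `a₂` term has no decay in `‖x‖` that could absorb an
    -- unbounded weight.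
    have hD2 : D * s ^ k ≤ T ^ ((k : ℝ) / n) := hmin2 _
    have hsT : s ^ k ≤ T ^ ((k : ℝ) / n) := by
      have := mul_pow_rpow_div hn k zero_le_one hs0.le
      rw [one_mul, Real.one_rpow, one_mul, hs, rpow_one_div_pow hn ht.1.le] at this
      rw [hs, ← this]
      exact Real.rpow_le_rpow ht.1.le ht.2.le hkn
    have hq : (2 / ‖x‖) ^ k * s ^ k * (1 + D) ≤ 1 + v := by
      have e1 : (2 / ‖x‖) ^ k * s ^ k * (‖x‖ / 2 / s) ^ k = 1 := by
        rw [← mul_pow, ← mul_pow]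
        have : 2 / ‖x‖ * s * (‖x‖ / 2 / s) = 1 := by field_simp
        rw [this, one_pow]
      have e2 : (2 / ‖x‖) ^ k * s ^ k ≤ 1 := by
        rw [← mul_pow]
        refine pow_le_one₀ (by positivity) ?_
        rw [div_mul_eq_mul_div, div_le_one hx0]
        nlinarith
      have e3 : (2 / ‖x‖) ^ k * s ^ k * D ≤ (2 / ‖x‖) ^ k * s ^ k * (v * (‖x‖ / 2 / s) ^ k) := by
        gcongr
      linear_combination e2 + e3 + v * e1
    have hhs : ‖h‖ ^ k ≤ s ^ k := by gcongr
    calc (a₁ * (2 / ‖x‖) ^ k + a₂) * ‖h‖ ^ k * Φ (‖x‖ / 2) * (1 + D)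
        ≤ (a₁ * (2 / ‖x‖) ^ k + a₂) * s ^ k * Φ (‖x‖ / 2) * (1 + D) := by gcongr
      _ = (a₁ * ((2 / ‖x‖) ^ k * s ^ k * (1 + D)) + a₂ * (s ^ k + D * s ^ k)) *
          Φ (‖x‖ / 2) := by ring
      _ ≤ (a₁ * (1 + v) + a₂ * (T ^ ((k : ℝ) / n) + T ^ ((k : ℝ) / n))) * Φ (‖x‖ / 2) := by
        gcongr
      _ = _ := by ring

end Weight

/-! ### Integrals of `φ` and the constant `c₀`. -/

section Profile

variable {n : ℕ} {Φ : ℝ → ℝ}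

theorem rpow_div_ballVol_pos {τ : ℝ} (hτ : 0 < τ) : 0 < (τ / ballVol n) ^ (1 / (n : ℝ)) :=
  Real.rpow_pos_of_pos (div_pos hτ (ballVol_pos n)) _

theorem IsStandardProfile.phi_nonneg (hΦ : IsStandardProfile n Φ) {τ : ℝ} (hτ : 0 < τ) :
    0 ≤ phi n Φ τ :=
  hΦ.nonneg _ (rpow_div_ballVol_pos hτ)

theorem IsStandardProfile.antitoneOn_phi (hΦ : IsStandardProfile n Φ) :
    AntitoneOn (phi n Φ) (Ioi 0) := by
  intro x hx y hy hxy
  have hV := ballVol_pos n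
  have hx0 : 0 < x := hx
  refine hΦ.antitoneOn (rpow_div_ballVol_pos hx) (rpow_div_ballVol_pos hy) ?_
  gcongr

theorem IsStandardProfile.continuousOn_phi (hΦ : IsStandardProfile n Φ) :
    ContinuousOn (phi n Φ) (Ioi 0) := by
  refine hΦ.continuousOn.comp (fun τ hτ => ?_) fun τ hτ => rpow_div_ballVol_pos hτ
  have h1 : ContinuousAt (fun τ : ℝ => τ / ballVol n) τ := by fun_prop
  exact (h1.rpow_const (Or.inl (div_pos hτ (ballVol_pos n)).ne')).continuousWithinAt

/-- Substitution `τ = V_n z^n`. -/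
theorem lintegral_phi_eq (hn : 1 ≤ n) (Φ : ℝ → ℝ) :
    ∫⁻ τ in Ioi (0 : ℝ), ENNReal.ofReal (phi n Φ τ) =
      ENNReal.ofReal (ballVol n * n) *
        ∫⁻ z in Ioi (0 : ℝ), ENNReal.ofReal (Φ z * z ^ (n - 1)) := by
  have hV := ballVol_pos n
  have hn0 : n ≠ 0 := by omega
  have himg : (fun z : ℝ => ballVol n * z ^ n) '' Ioi 0 = Ioi 0 := by
    ext τ
    constructor
    · rintro ⟨z, hz, rfl⟩
      exact mul_pos hV (pow_pos hz n)
    · intro hτ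
      refine ⟨(τ / ballVol n) ^ (1 / (n : ℝ)), rpow_div_ballVol_pos hτ, ?_⟩
      change ballVol n * _ = τ
      rw [rpow_one_div_pow hn (div_pos hτ hV).le, mul_div_cancel₀ _ hV.ne']
  have hcv := lintegral_image_eq_lintegral_abs_deriv_mul (measurableSet_Ioi (a := (0 : ℝ)))
    (f := fun z : ℝ => ballVol n * z ^ n) (f' := fun z => ballVol n * (n * z ^ (n - 1)))
    (fun x _ => ((hasDerivAt_pow n x).const_mul (ballVol n)).hasDerivWithinAt)
    (fun x hx y hy hxy => by
      have h1 : x ^ n = y ^ n := mul_left_cancel₀ hV.ne' hxy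
      exact (pow_left_inj₀ (le_of_lt hx) (le_of_lt hy) hn0).1 h1)
    (fun τ => ENNReal.ofReal (phi n Φ τ))
  rw [himg] at hcv
  rw [hcv, ← lintegral_const_mul' _ _ ENNReal.ofReal_ne_top]
  refine setLIntegral_congr_fun measurableSet_Ioi fun z hz => ?_
  have hz0 : 0 < z := hz
  have h1 : phi n Φ (ballVol n * z ^ n) = Φ z := by
    rw [phi, mul_div_cancel_left₀ _ hV.ne', one_div, Real.pow_rpow_inv_natCast hz0.le hn0]
  simp only [h1]
  rw [abs_of_nonneg (by positivity), ← ENNReal.ofReal_mul (by positivity),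
    ← ENNReal.ofReal_mul (by positivity)]
  congr 1
  ring

theorem IsStandardProfile.lintegral_phi_lt_top (hΦ : IsStandardProfile n Φ) (hn : 1 ≤ n) :
    ∫⁻ τ in Ioi (0 : ℝ), ENNReal.ofReal (phi n Φ τ) < ∞ := by
  rw [lintegral_phi_eq hn]
  exact ENNReal.mul_lt_top ENNReal.ofReal_lt_top hΦ.integral_lt_top

theorem IsStandardProfile.integrableOn_phi (hΦ : IsStandardProfile n Φ) (hn : 1 ≤ n) :
    IntegrableOn (phi n Φ) (Ioi 0) := by
  refine ⟨hΦ.continuousOn_phi.aestronglyMeasurable measurableSet_Ioi, ?_⟩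
  rw [hasFiniteIntegral_iff_ofReal]
  · exact hΦ.lintegral_phi_lt_top hn
  · filter_upwards [self_mem_ae_restrict measurableSet_Ioi] with τ hτ using hΦ.phi_nonneg hτ

theorem IsStandardProfile.ofReal_integral_phi (hΦ : IsStandardProfile n Φ) (hn : 1 ≤ n)
    {s : Set ℝ} (hs : MeasurableSet s) (hs0 : s ⊆ Ioi 0) :
    ENNReal.ofReal (∫ τ in s, phi n Φ τ) = ∫⁻ τ in s, ENNReal.ofReal (phi n Φ τ) := by
  refine ofReal_integral_eq_lintegral_ofReal ((hΦ.integrableOn_phi hn).mono_set hs0) ?_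
  filter_upwards [self_mem_ae_restrict hs] with τ hτ using hΦ.phi_nonneg (hs0 hτ)

theorem IsStandardProfile.exists_phi_pos (hΦ : IsStandardProfile n Φ) (hn : 1 ≤ n) :
    ∃ τ, 0 < τ ∧ 0 < phi n Φ τ := by
  by_contra! h
  have h0 : ∫⁻ τ in Ioi (0 : ℝ), ENNReal.ofReal (phi n Φ τ) = 0 := by
    rw [setLIntegral_congr_fun (g := fun _ => 0) measurableSet_Ioi
      fun τ hτ => ENNReal.ofReal_of_nonpos (h τ hτ)]
    simp
  rw [lintegral_phi_eq hn, mul_eq_zero] at h0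
  rcases h0 with h0 | h0
  · have : (0 : ℝ) < n := by exact_mod_cast hn
    exact absurd h0 (ENNReal.ofReal_pos.2 (mul_pos (ballVol_pos n) this)).ne'
  · exact absurd h0 hΦ.integral_pos.ne'

theorem IsStandardProfile.integral_phi_pos (hΦ : IsStandardProfile n Φ) (hn : 1 ≤ n) {T : ℝ}
    (hT : 0 < T) : 0 < ∫ τ in Ioo 0 T, phi n Φ τ := by
  obtain ⟨τ, hτ, hpos⟩ := hΦ.exists_phi_pos hn
  rw [← ENNReal.ofReal_pos, hΦ.ofReal_integral_phi hn measurableSet_Ioo Ioo_subset_Ioi_self]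
  have hm : 0 < min τ T := lt_min hτ hT
  calc (0 : ℝ≥0∞) < ∫⁻ _ in Ioo 0 (min τ T), ENNReal.ofReal (phi n Φ τ) := by
        rw [setLIntegral_const, Real.volume_Ioo, sub_zero]
        exact ENNReal.mul_pos (ENNReal.ofReal_pos.2 hpos).ne' (ENNReal.ofReal_pos.2 hm).ne'
    _ ≤ ∫⁻ x in Ioo 0 (min τ T), ENNReal.ofReal (phi n Φ x) := by
        refine setLIntegral_mono_ae' measurableSet_Ioo (Filter.Eventually.of_forall fun x hx => ?_)
        exact ENNReal.ofReal_le_ofReal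
          (hΦ.antitoneOn_phi hx.1 hτ (hx.2.le.trans (min_le_left _ _)))
    _ ≤ _ := lintegral_mono_set (Ioo_subset_Ioo_right (min_le_right _ _))

theorem IsStandardProfile.one_le_tailConst (hΦ : IsStandardProfile n Φ) (hn : 1 ≤ n) {T : ℝ}
    (hT : 0 < T) : 1 ≤ tailConst n Φ T := by
  rw [tailConst, le_add_iff_nonneg_right]
  refine div_nonneg ?_ (hΦ.integral_phi_pos hn hT).le
  exact setIntegral_nonneg measurableSet_Ioi fun τ hτ => hΦ.phi_nonneg (hT.trans hτ)

/-- Against a decreasing function, the tail of `φ` is controlled by its part on `(0, T)`. -/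
theorem IsStandardProfile.lintegral_phi_mul_le (hΦ : IsStandardProfile n Φ) (hn : 1 ≤ n) {T : ℝ}
    (hT : 0 < T) {χ : ℝ → ℝ≥0∞} (hχ : AntitoneOn χ (Ioi 0)) :
    ∫⁻ τ in Ioi (0 : ℝ), ENNReal.ofReal (phi n Φ τ) * χ τ ≤
      ENNReal.ofReal (tailConst n Φ T) *
        ∫⁻ τ in Ioo 0 T, ENNReal.ofReal (phi n Φ τ) * χ τ := by
  have hB := hΦ.integral_phi_pos hn hT
  have hA : 0 ≤ ∫ τ in Ioi T, phi n Φ τ :=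
    setIntegral_nonneg measurableSet_Ioi fun τ hτ => hΦ.phi_nonneg (hT.trans hτ)
  have hφm : AEMeasurable (fun τ => ENNReal.ofReal (phi n Φ τ)) (volume.restrict (Ioi 0)) :=
    (hΦ.continuousOn_phi.aemeasurable measurableSet_Ioi).ennreal_ofReal
  set q := (∫ τ in Ioi T, phi n Φ τ) / ∫ τ in Ioo 0 T, phi n Φ τ with hq
  have hq0 : 0 ≤ q := div_nonneg hA hB.le
  have htail : ∫⁻ τ in Ioi T, ENNReal.ofReal (phi n Φ τ) =
      ENNReal.ofReal q * ∫⁻ τ in Ioo 0 T, ENNReal.ofReal (phi n Φ τ) := by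
    rw [← hΦ.ofReal_integral_phi hn measurableSet_Ioi (Ioi_subset_Ioi hT.le),
      ← hΦ.ofReal_integral_phi hn measurableSet_Ioo Ioo_subset_Ioi_self,
      ← ENNReal.ofReal_mul hq0, hq, div_mul_cancel₀ _ hB.ne']
  have hsplit : Ioi (0 : ℝ) = Ioc 0 T ∪ Ioi T := (Ioc_union_Ioi_eq_Ioi hT.le).symm
  rw [hsplit, lintegral_union measurableSet_Ioi
    (Set.disjoint_left.2 fun x (hx : x ∈ Ioc 0 T) (hx' : x ∈ Ioi T) => not_lt.2 hx.2 hx'),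
    tailConst, ← hq,
    ENNReal.ofReal_add zero_le_one hq0, ENNReal.ofReal_one, add_mul, one_mul,
    setLIntegral_congr Ioo_ae_eq_Ioc.symm]
  gcongr
  -- Compare through `χ T`, which dominates `χ` beyond `T` and is dominated by it before `T`; `q` is
  -- the ratio of the two masses of `φ`.
  calc ∫⁻ τ in Ioi T, ENNReal.ofReal (phi n Φ τ) * χ τ
      ≤ ∫⁻ τ in Ioi T, ENNReal.ofReal (phi n Φ τ) * χ T := by
        refine setLIntegral_mono_ae' measurableSet_Ioi (Filter.Eventually.of_forall fun x hx => ?_)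
        gcongr
        exact hχ hT (hT.trans hx) (le_of_lt hx)
    _ = (∫⁻ τ in Ioi T, ENNReal.ofReal (phi n Φ τ)) * χ T :=
        lintegral_mul_const'' _ (hφm.mono_set (Ioi_subset_Ioi hT.le))
    _ = ENNReal.ofReal q * ∫⁻ τ in Ioo 0 T, ENNReal.ofReal (phi n Φ τ) * χ T := by
        rw [htail, mul_assoc, lintegral_mul_const'' _ (hφm.mono_set Ioo_subset_Ioi_self)]
    _ ≤ _ := by
        refine mul_le_mul' le_rfl ?_
        refine setLIntegral_mono_ae' measurableSet_Ioo (Filter.Eventually.of_forall fun x hx => ?_)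
        gcongr
        exact hχ hx.1 hT hx.2.le

end Profile

/-! ### Convergence of potentials and their differences. -/

section Potential

variable {n : ℕ} {Φ : ℝ → ℝ} {f : EuclideanSpace ℝ (Fin n) → ℂ}

theorem IsStandardProfile.integrable_potential (hΦ : IsStandardProfile n Φ) (hn : 1 ≤ n)
    (hf : AEMeasurable f volume) (hfin : ∫⁻ τ in Ioi (0 : ℝ), ENNReal.ofReal (phi n Φ τ) *
      rearr volume (fun x => ‖f x‖ₑ) τ < ∞) (x : EuclideanSpace ℝ (Fin n)) :
    Integrable (fun y => (Φ ‖x - y‖ : ℂ) * f y) volume := by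
  have hφm : AEMeasurable (phi n Φ) volPos := hΦ.continuousOn_phi.aemeasurable measurableSet_Ioi
  have hp := measurePreserving_radialVol_sub hn x
  have hm : AEMeasurable (fun y => Φ ‖x - y‖) volume := by
    have := hφm.comp_quasiMeasurePreserving hp.quasiMeasurePreserving
    exact this.congr (Filter.Eventually.of_forall fun y => phi_radialVol hn Φ (x - y))
  refine ⟨((Complex.measurable_ofReal.comp_aemeasurable hm).mul hf).aestronglyMeasurable, ?_⟩
  refine lt_of_le_of_lt ?_ hfin
  have hanti : AntitoneOn (fun τ => ‖phi n Φ τ‖ₑ) (Ioi 0) := by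
    intro a ha b hb hab
    simp only [Real.enorm_of_nonneg (hΦ.phi_nonneg ha), Real.enorm_of_nonneg (hΦ.phi_nonneg hb)]
    exact ENNReal.ofReal_le_ofReal (hΦ.antitoneOn_phi ha hb hab)
  have := lintegral_antitone_comp_mul_le hp hanti hf.enorm
  simp only [phi_radialVol hn] at this
  calc ∫⁻ y, ‖(Φ ‖x - y‖ : ℂ) * f y‖ₑ = ∫⁻ y, ‖Φ ‖x - y‖‖ₑ * ‖f y‖ₑ := by
        refine lintegral_congr fun y => ?_
        rw [enorm_mul]
        congr 1
        rw [← ofReal_norm, ← ofReal_norm, Complex.norm_real]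
    _ ≤ _ := this
    _ = _ := setLIntegral_congr_fun measurableSet_Ioi fun τ hτ => by
        simp only [Real.enorm_of_nonneg (hΦ.phi_nonneg hτ)]

theorem fwdDiff_radial_mul_eq_sum (k : ℕ) (Φ : ℝ → ℝ) (f : EuclideanSpace ℝ (Fin n) → ℂ)
    (h x y : EuclideanSpace ℝ (Fin n)) :
    (((fwdDiff h)^[k] (fun z => Φ ‖z‖) (x - y) : ℝ) : ℂ) * f y =
      ∑ j ∈ Finset.range (k + 1), ((-1 : ℤ) ^ (k - j) * k.choose j) •
        ((Φ ‖x + j • h - y‖ : ℂ) * f y) := by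
  rw [fwdDiff_iter_eq_sum_shift, Complex.ofReal_sum, Finset.sum_mul]
  refine Finset.sum_congr rfl fun j _ => ?_
  rw [← smul_mul_assoc, zsmul_eq_mul, zsmul_eq_mul, add_sub_right_comm]
  push_cast
  rfl

theorem integrable_fwdDiff_potential
    (hint : ∀ x, Integrable (fun y => (Φ ‖x - y‖ : ℂ) * f y) volume)
    (k : ℕ) (h x : EuclideanSpace ℝ (Fin n)) :
    Integrable (fun y => (((fwdDiff h)^[k] (fun z => Φ ‖z‖) (x - y) : ℝ) : ℂ) * f y) volume := by
  simp only [fwdDiff_radial_mul_eq_sum]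
  exact integrable_finsetSum _ fun j _ => (hint _).smul _

/-- Integrability of every translate is what allows the finite sum to pass under the Bochner
integral. -/
theorem iterate_fwdDiff_potential
    (hint : ∀ x, Integrable (fun y => (Φ ‖x - y‖ : ℂ) * f y) volume)
    (k : ℕ) (h x : EuclideanSpace ℝ (Fin n)) :
    (fwdDiff h)^[k] (potential Φ f) x =
      ∫ y, (((fwdDiff h)^[k] (fun z => Φ ‖z‖) (x - y) : ℝ) : ℂ) * f y := by
  simp only [fwdDiff_radial_mul_eq_sum]
  refine Eq.trans ?_ (integral_finsetSum _ fun j _ => (hint (x + j • h)).smul _).symm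
  rw [fwdDiff_iter_eq_sum_shift]
  refine Finset.sum_congr rfl fun j _ => ?_
  simp only [zsmul_eq_mul]
  exact (integral_const_mul _ fun y => (Φ ‖x + j • h - y‖ : ℂ) * f y).symm

theorem radialVol_half_smul (x : EuclideanSpace ℝ (Fin n)) :
    radialVol ((1 / 2 : ℝ) • x) = radialVol x / 2 ^ n := by
  rw [radialVol, radialVol, norm_smul, mul_pow,
    Real.norm_of_nonneg (by norm_num), div_pow, one_pow]
  ring

end Potential

/-! ### The upper bound for the modulus of smoothness. -/

section UpperBound

variable {n : ℕ} {Φ : ℝ → ℝ}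

/-- The weight of `cutKernel`, as a decreasing function. -/
theorem antitoneOn_cutWeight (n k : ℕ) {T t : ℝ} (hT : 0 < T) (ht : 0 < t) :
    AntitoneOn (fun τ => 1 / (1 + (min τ T / t) ^ ((k : ℝ) / (n : ℝ)))) (Ioi 0) := by
  intro x hx y hy hxy
  have hx0 : 0 < x := hx
  have h0 : 0 < min x T := lt_min hx hT
  have h1 : min x T ≤ min y T := min_le_min_right _ hxy
  simp only
  gcongr

theorem cutWeight_nonneg (n k : ℕ) {T t τ : ℝ} (hT : 0 < T) (ht : 0 < t) (hτ : 0 < τ) :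
    0 ≤ 1 / (1 + (min τ T / t) ^ ((k : ℝ) / (n : ℝ))) := by
  have := lt_min hτ hT
  positivity

theorem cutKernel_eq_mul (n k : ℕ) (Φ : ℝ → ℝ) (T t τ : ℝ) : cutKernel n k Φ T t τ =
    phi n Φ τ * (1 / (1 + (min τ T / t) ^ ((k : ℝ) / (n : ℝ)))) := by
  rw [cutKernel, div_eq_mul_one_div]

theorem IsStandardProfile.enorm_cutKernel (hΦ : IsStandardProfile n Φ) (k : ℕ) {T t τ : ℝ}
    (hτ : 0 < τ) : ‖cutKernel n k Φ T t τ‖ₑ = ENNReal.ofReal (phi n Φ τ) *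
      ‖1 / (1 + (min τ T / t) ^ ((k : ℝ) / (n : ℝ)))‖ₑ := by
  rw [cutKernel_eq_mul, enorm_mul, Real.enorm_of_nonneg (hΦ.phi_nonneg hτ)]

theorem antitoneOn_enorm_cutWeight (n k : ℕ) {T t : ℝ} (hT : 0 < T) (ht : 0 < t) :
    AntitoneOn (fun τ => ‖1 / (1 + (min τ T / t) ^ ((k : ℝ) / (n : ℝ)))‖ₑ) (Ioi 0) := by
  intro x hx y hy hxy
  simp only [Real.enorm_of_nonneg (cutWeight_nonneg n k hT ht hx),
    Real.enorm_of_nonneg (cutWeight_nonneg n k hT ht hy)]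
  exact ENNReal.ofReal_le_ofReal (antitoneOn_cutWeight n k hT ht hx hy hxy)

theorem IsStandardProfile.antitoneOn_cutKernel (hΦ : IsStandardProfile n Φ) (k : ℕ) {T t : ℝ}
    (hT : 0 < T) (ht : 0 < t) : AntitoneOn (fun τ => ‖cutKernel n k Φ T t τ‖ₑ) (Ioi 0) := by
  intro x hx y hy hxy
  simp only [hΦ.enorm_cutKernel k hx, hΦ.enorm_cutKernel k hy]
  gcongr
  · exact hΦ.antitoneOn_phi hx hy hxy
  · exact antitoneOn_enorm_cutWeight n k hT ht hx hy hxy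

/-- The truncated weight decreases, so it joins `χ` in the tail estimate for `φ`; on `(0, T)` the
truncation has no effect. -/
theorem IsStandardProfile.lintegral_cutKernel_mul_le (hΦ : IsStandardProfile n Φ) (hn : 1 ≤ n)
    (k : ℕ) {T t : ℝ} (hT : 0 < T) (ht : 0 < t) {χ : ℝ → ℝ≥0∞} (hχ : AntitoneOn χ (Ioi 0)) :
    ∫⁻ τ in Ioi (0 : ℝ), ‖cutKernel n k Φ T t τ‖ₑ * χ τ ≤ ENNReal.ofReal (tailConst n Φ T) *
      ∫⁻ τ in Ioo 0 T, ENNReal.ofReal (OmegaPhi n k Φ t τ) * χ τ := by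
  have hanti : AntitoneOn (fun τ => ‖1 / (1 + (min τ T / t) ^ ((k : ℝ) / (n : ℝ)))‖ₑ * χ τ)
      (Ioi 0) := by
    intro x hx y hy hxy
    exact mul_le_mul' (antitoneOn_enorm_cutWeight n k hT ht hx hy hxy) (hχ hx hy hxy)
  have h1 := hΦ.lintegral_phi_mul_le hn hT hanti
  rw [setLIntegral_congr_fun measurableSet_Ioi
    fun τ hτ => show _ = ENNReal.ofReal (phi n Φ τ) *
      (‖1 / (1 + (min τ T / t) ^ ((k : ℝ) / (n : ℝ)))‖ₑ * χ τ) by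
        rw [hΦ.enorm_cutKernel k hτ, mul_assoc]]
  refine h1.trans_eq ?_
  congr 1
  refine setLIntegral_congr_fun measurableSet_Ioo fun τ hτ => ?_
  rw [Real.enorm_of_nonneg (cutWeight_nonneg n k hT ht hτ.1), ← mul_assoc,
    ← ENNReal.ofReal_mul (hΦ.phi_nonneg hτ.1), ← div_eq_mul_one_div, min_eq_left hτ.2.le, OmegaPhi]

theorem exists_modulus_le (k n : ℕ) (hk : 1 ≤ k) (hn : 1 ≤ n) {a₁ a₂ T : ℝ}
    (h₁ : 0 < a₁) (h₂ : 0 < a₂) (hT : 0 < T) : ∃ C : ℝ, 0 < C ∧ ∀ (z₁ : ℝ) (Φ : ℝ → ℝ),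
      IsStandardProfile n Φ → DerivUpperBounds k Φ z₁ a₁ a₂ →
      ∀ f : EuclideanSpace ℝ (Fin n) → ℂ, AEMeasurable f volume → ∀ t ∈ Ioo 0 T,
        modulus k (potential Φ f) (t ^ (1 / (n : ℝ))) ≤ ENNReal.ofReal (C * tailConst n Φ T) *
          ∫⁻ τ in Ioo 0 T, ENNReal.ofReal (OmegaPhi n k Φ t τ) *
            rearr volume (fun x => ‖f x‖ₑ) τ := by
  obtain ⟨C, hC, hbound⟩ := exists_abs_fwdDiff_le_cutKernel k n hk hn h₁ h₂ hT
  -- Each of the `k + 1` translates contributes one copy of `J`; the kernel at `(x - y)/2` is a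
  -- dilation in volume by `2^n` and contributes `2^n` copies.
  refine ⟨C * (k + 1 + 2 ^ n), by positivity, fun z₁ Φ hΦ hd f hf t ht => ?_⟩
  set fs := rearr volume (fun x => ‖f x‖ₑ) with hfs
  set I := ∫⁻ τ in Ioo 0 T, ENNReal.ofReal (OmegaPhi n k Φ t τ) * fs τ with hI
  have hc := hΦ.one_le_tailConst hn hT
  have hcC : 0 < C * (k + 1 + 2 ^ n) * tailConst n Φ T := by positivity
  rcases eq_or_ne I ∞ with hItop | hItop
  · rw [hItop, ENNReal.mul_top (ENNReal.ofReal_pos.2 hcC).ne']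
    exact le_top
  have hanti : AntitoneOn fs (Ioi 0) := (rearr_antitone _).antitoneOn _
  set J := ∫⁻ τ in Ioi (0 : ℝ), ‖cutKernel n k Φ T t τ‖ₑ * fs τ with hJ
  have hJI : J ≤ ENNReal.ofReal (tailConst n Φ T) * I :=
    hΦ.lintegral_cutKernel_mul_le hn k hT ht.1 hanti
  have hcut := hΦ.antitoneOn_cutKernel k hT ht.1
  -- The truncated weight is at least its value `w > 0` at `T`, so finiteness of `I` already makes
  -- the potential converge absolutely.
  have hfin : ∫⁻ τ in Ioi (0 : ℝ), ENNReal.ofReal (phi n Φ τ) * fs τ < ∞ := by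
    set w := ‖1 / (1 + (T / t) ^ ((k : ℝ) / (n : ℝ)))‖ₑ with hw
    have hw0 : w ≠ 0 := by
      rw [hw, Ne, enorm_eq_zero]
      have := ht.1
      positivity
    have h1 : w * ∫⁻ τ in Ioi (0 : ℝ), ENNReal.ofReal (phi n Φ τ) * fs τ ≤ J := by
      rw [hJ, ← lintegral_const_mul' _ _ enorm_ne_top]
      refine setLIntegral_mono_ae' measurableSet_Ioi (Filter.Eventually.of_forall fun τ hτ => ?_)
      rw [hΦ.enorm_cutKernel k hτ, ← mul_assoc, mul_comm w]
      gcongr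
      have hτT : 0 < max τ T := lt_max_of_lt_right hT
      have := antitoneOn_enorm_cutWeight n k hT ht.1 hτ hτT (le_max_left _ _)
      simpa [hw, min_eq_right (le_max_right τ T)] using this
    have h2 : w * ∫⁻ τ in Ioi (0 : ℝ), ENNReal.ofReal (phi n Φ τ) * fs τ < ∞ :=
      h1.trans_lt (hJI.trans_lt (ENNReal.mul_lt_top ENNReal.ofReal_lt_top hItop.lt_top))
    by_contra htop
    rw [not_lt, top_le_iff] at htop
    rw [htop, ENNReal.mul_top hw0] at h2
    exact lt_irrefl _ h2
  have hint := fun x => hΦ.integrable_potential hn hf hfin x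
  refine iSup_le fun h => iSup_le fun hh => iSup_le fun x => ?_
  rw [iterate_fwdDiff_potential hint]
  have hcm : ∀ p : EuclideanSpace ℝ (Fin n) → ℝ, MeasurePreserving p volume volPos →
      AEMeasurable (fun y => ‖cutKernel n k Φ T t (p y)‖ₑ) volume := fun p hp =>
    (aemeasurable_volPos_of_antitoneOn hcut).comp_quasiMeasurePreserving hp.quasiMeasurePreserving
  have hpt : ∀ y, ‖(((fwdDiff h)^[k] (fun z => Φ ‖z‖) (x - y) : ℝ) : ℂ) * f y‖ₑ ≤
      ENNReal.ofReal C * ((∑ j ∈ Finset.range (k + 1),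
        ‖cutKernel n k Φ T t (radialVol (x + j • h - y))‖ₑ * ‖f y‖ₑ) +
        ‖cutKernel n k Φ T t (radialVol (x - y) / 2 ^ n)‖ₑ * ‖f y‖ₑ) := by
    intro y
    have h1 := hbound z₁ Φ hd hΦ.nonneg hΦ.antitoneOn t ht h hh (x - y)
    rw [enorm_mul, ← ofReal_norm, Complex.norm_real, Real.norm_eq_abs,
      ← Finset.sum_mul, ← add_mul, ← mul_assoc]
    gcongr
    refine (ENNReal.ofReal_le_ofReal h1).trans_eq ?_
    rw [ENNReal.ofReal_mul hC.le, ENNReal.ofReal_add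
      (Finset.sum_nonneg fun _ _ => abs_nonneg _) (abs_nonneg _),
      ENNReal.ofReal_sum_of_nonneg fun _ _ => abs_nonneg _, radialVol_half_smul]
    simp only [← Real.norm_eq_abs, ofReal_norm, add_sub_right_comm]
  have h2n : (1 : ℝ) ≤ 2 ^ n := one_le_pow₀ one_le_two
  have hdil : AntitoneOn (fun τ => ‖cutKernel n k Φ T t (τ / 2 ^ n)‖ₑ) (Ioi 0) := by
    intro a ha b hb hab
    have h2 : (0 : ℝ) < 2 ^ n := by positivity
    exact hcut (div_pos ha h2) (div_pos hb h2) (by gcongr)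
  calc ‖∫ y, (((fwdDiff h)^[k] (fun z => Φ ‖z‖) (x - y) : ℝ) : ℂ) * f y‖ₑ
      ≤ ∫⁻ y, ‖(((fwdDiff h)^[k] (fun z => Φ ‖z‖) (x - y) : ℝ) : ℂ) * f y‖ₑ :=
        enorm_integral_le_lintegral_enorm _
    _ ≤ ∫⁻ y, ENNReal.ofReal C * ((∑ j ∈ Finset.range (k + 1),
        ‖cutKernel n k Φ T t (radialVol (x + j • h - y))‖ₑ * ‖f y‖ₑ) +
        ‖cutKernel n k Φ T t (radialVol (x - y) / 2 ^ n)‖ₑ * ‖f y‖ₑ) := lintegral_mono hpt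
    _ = ENNReal.ofReal C * ((∑ j ∈ Finset.range (k + 1),
        ∫⁻ y, ‖cutKernel n k Φ T t (radialVol (x + j • h - y))‖ₑ * ‖f y‖ₑ) +
        ∫⁻ y, ‖cutKernel n k Φ T t (radialVol (x - y) / 2 ^ n)‖ₑ * ‖f y‖ₑ) := by
        have hmj : ∀ c : EuclideanSpace ℝ (Fin n), AEMeasurable (fun y =>
            ‖cutKernel n k Φ T t (radialVol (c - y))‖ₑ * ‖f y‖ₑ) volume := fun c =>
          (hcm _ (measurePreserving_radialVol_sub hn c)).mul hf.enorm
        rw [lintegral_const_mul' _ _ ENNReal.ofReal_ne_top, lintegral_add_left',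
          lintegral_finsetSum' _ fun j _ => hmj _]
        exact Finset.aemeasurable_fun_sum _ fun j _ => hmj _
    _ ≤ ENNReal.ofReal C * ((∑ j ∈ Finset.range (k + 1), J) + ENNReal.ofReal (2 ^ n) * J) := by
        gcongr with j hj
        · exact lintegral_antitone_comp_mul_le (measurePreserving_radialVol_sub hn _) hcut hf.enorm
        · exact (lintegral_antitone_comp_mul_le (measurePreserving_radialVol_sub hn x) hdil
            hf.enorm).trans (lintegral_comp_div_mul_le (ψ := fun τ => ‖cutKernel n k Φ T t τ‖ₑ)
              hanti h2n)
    _ = ENNReal.ofReal (C * (k + 1 + 2 ^ n)) * J := by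
        rw [ENNReal.ofReal_mul hC.le, ENNReal.ofReal_add (by positivity) (by positivity),
          Finset.sum_const, Finset.card_range, nsmul_eq_mul, mul_assoc, ← add_mul]
        congr 3
        rw [← Nat.cast_add_one, ENNReal.ofReal_natCast]
    _ ≤ ENNReal.ofReal (C * (k + 1 + 2 ^ n)) * (ENNReal.ofReal (tailConst n Φ T) * I) := by
        gcongr
    _ = _ := by rw [← mul_assoc, ← ENNReal.ofReal_mul (by positivity)]

end UpperBound

/-! ### Differences of the kernel in a cone, from below. -/

section LowerPointwise

/-- The sum bounds the loss in passing from the radial to a directional derivative. It is continuous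
in `γ` and vanishes at `γ = 1`. -/
theorem exists_cone_aperture (k : ℕ) {a₁ δ₁ : ℝ} (hδ : 0 < δ₁) : ∃ γ : ℝ, 0 < γ ∧ γ < 1 ∧
    ∑ j ∈ Finset.range (k + 1), (radialCoeff k j : ℝ) * (a₁ * (1 - γ ^ (2 * j - k))) ≤ δ₁ / 2 := by
  have hc : Continuous fun γ : ℝ =>
      ∑ j ∈ Finset.range (k + 1), (radialCoeff k j : ℝ) * (a₁ * (1 - γ ^ (2 * j - k))) := by
    fun_prop
  have h1 : ∀ᶠ γ in nhds (1 : ℝ),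
      ∑ j ∈ Finset.range (k + 1), (radialCoeff k j : ℝ) * (a₁ * (1 - γ ^ (2 * j - k))) < δ₁ / 2 :=
    hc.continuousAt.eventually_lt_const (by simpa using hδ)
  have h2 : ∀ᶠ γ in nhdsWithin (1 : ℝ) (Iio 1), γ ∈ Ioo (0 : ℝ) 1 :=
    Ioo_mem_nhdsLT zero_lt_one
  obtain ⟨γ, h3, h4⟩ := ((h1.filter_mono nhdsWithin_le_nhds).and h2).exists
  exact ⟨γ, h4.1, h4.2, h3.le⟩

/-- At `p = r` this is the hypothesis on `Φ^{(k)}`. Moving `p` down to at least `γ r` changes each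
power by at most `r^{2j-k} (1 - γ^{2j-k})`, which by `hsum` costs half of `δ₁`. -/
theorem le_radialPoly_of_cone {k : ℕ} (hk : 1 ≤ k) {Φ : ℝ → ℝ} {z₁ a₁ a₂ δ₁ γ r p : ℝ}
    (hd : DerivUpperBounds k Φ z₁ a₁ a₂) (hl : DerivLowerBound k Φ z₁ δ₁) (hγ : 0 < γ)
    (hsum : ∑ j ∈ Finset.range (k + 1),
      (radialCoeff k j : ℝ) * (a₁ * (1 - γ ^ (2 * j - k))) ≤ δ₁ / 2)
    (hr : r ∈ Ioc 0 z₁) (hΦ : 0 ≤ Φ r) (hp : γ * r ≤ p) (hpr : p ≤ r) :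
    δ₁ / 2 * (Φ r / r ^ k) ≤ (-1) ^ k * radialPoly Φ k r p 1 := by
  have hr0 := hr.1
  have h1 : δ₁ * Φ r ≤ (-1) ^ k * r ^ k * radialPoly Φ k r r 1 := by
    rw [← iteratedDeriv_eq_radialPoly hd.contDiffOn le_rfl hr0]
    exact hl r hr
  have h2 : r ^ k * |radialPoly Φ k r r 1 - radialPoly Φ k r p 1| ≤ δ₁ / 2 * Φ r := by
    rw [radialPoly, radialPoly, ← Finset.sum_sub_distrib]
    calc _ ≤ r ^ k * ∑ j ∈ Finset.range (k + 1), |(radialCoeff k j : ℝ) * (radialDeriv j Φ r *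
          (r ^ (2 * j - k) * 1 ^ (k - j))) - (radialCoeff k j : ℝ) * (radialDeriv j Φ r *
          (p ^ (2 * j - k) * 1 ^ (k - j)))| := by
          gcongr
          exact Finset.abs_sum_le_sum_abs _ _
      _ ≤ (∑ j ∈ Finset.range (k + 1),
          (radialCoeff k j : ℝ) * (a₁ * (1 - γ ^ (2 * j - k)))) * Φ r := by
        rw [Finset.mul_sum, Finset.sum_mul]
        refine Finset.sum_le_sum fun j hj => ?_
        rcases Nat.lt_or_ge (2 * j) k with h | h
        · simp [radialCoeff_eq_zero_of_two_mul_lt h]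
        have hjm : j ∈ Finset.Icc 1 k := by
          have := Finset.mem_range.1 hj
          rw [Finset.mem_Icc]
          omega
        have hpow : (γ * r) ^ (2 * j - k) ≤ p ^ (2 * j - k) := by gcongr
        have hp0 : 0 ≤ p := le_trans (by positivity) hp
        have hpow' : p ^ (2 * j - k) ≤ r ^ (2 * j - k) := by gcongr
        have hsplit : r ^ (2 * j) = r ^ k * r ^ (2 * j - k) := by rw [← pow_add]; congr 1; omega
        have hnear := hd.near r hr j hjm
        have hγ1 : γ ^ (2 * j - k) * r ^ (2 * j - k) ≤ r ^ (2 * j - k) := by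
          rw [← mul_pow]
          exact hpow.trans hpow'
        have hγ2 : 0 ≤ 1 - γ ^ (2 * j - k) := by
          have : 0 < r ^ (2 * j - k) := by positivity
          have := (mul_le_iff_le_one_left this).1 hγ1
          linarith
        rw [← mul_sub, ← mul_sub, one_pow, mul_one, mul_one, abs_mul, abs_mul, Nat.abs_cast,
          abs_of_nonneg (sub_nonneg.2 hpow')]
        calc r ^ k * ((radialCoeff k j : ℝ) *
              (|radialDeriv j Φ r| * (r ^ (2 * j - k) - p ^ (2 * j - k))))
            ≤ r ^ k * ((radialCoeff k j : ℝ) *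
              (|radialDeriv j Φ r| * (r ^ (2 * j - k) - (γ * r) ^ (2 * j - k)))) := by gcongr
          _ = (radialCoeff k j : ℝ) * ((r ^ (2 * j) * |radialDeriv j Φ r|) *
              (1 - γ ^ (2 * j - k))) := by rw [hsplit, mul_pow]; ring
          _ ≤ (radialCoeff k j : ℝ) * ((a₁ * Φ r) * (1 - γ ^ (2 * j - k))) := by gcongr
          _ = _ := by ring
      _ ≤ _ := by gcongr
  have h3 : (-1) ^ k * (radialPoly Φ k r r 1 - radialPoly Φ k r p 1) ≤
      |radialPoly Φ k r r 1 - radialPoly Φ k r p 1| := by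
    refine (le_abs_self _).trans_eq ?_
    rw [abs_mul, abs_pow, abs_neg, abs_one, one_pow, one_mul]
  have hrk : 0 < r ^ k := by positivity
  rw [← mul_div_assoc, div_le_iff₀ hrk]
  have h4 := mul_le_mul_of_nonneg_left h3 hrk.le
  linear_combination h1 + h2 + h4

/-- The doubling property of `Φ` near the origin. -/
theorem le_mul_rpow_of_near {k : ℕ} (hk : 1 ≤ k) {Φ : ℝ → ℝ} {z₁ a₁ a₂ : ℝ}
    (hd : DerivUpperBounds k Φ z₁ a₁ a₂) {l z : ℝ} (hl : 1 ≤ l) (hz : 0 < z) (hlz : l * z ≤ z₁) :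
    Φ z ≤ l ^ a₁ * Φ (l * z) := by
  have hderiv : ∀ x : ℝ, 0 < x → HasDerivAt (fun x => x ^ a₁ * Φ x)
      (a₁ * x ^ (a₁ - 1) * Φ x + x ^ a₁ * (x * radialDeriv 1 Φ x)) x := fun x hx =>
    (Real.hasDerivAt_rpow_const (Or.inl hx.ne')).mul
      (hasDerivAt_radialDeriv (j := 0) hd.contDiffOn hk hx)
  -- The bound for `j = 1` reads `x |Φ'(x)| ≤ a₁ Φ(x)`, so `x^{a₁} Φ(x)` increases.
  have hmono : MonotoneOn (fun x => x ^ a₁ * Φ x) (Icc z z₁) := by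
    refine monotoneOn_of_deriv_nonneg (convex_Icc _ _)
      (fun x hx => (hderiv x (hz.trans_le hx.1)).continuousAt.continuousWithinAt)
      (fun x hx => (hderiv x (hz.trans_le
        (interior_subset hx).1)).differentiableAt.differentiableWithinAt) fun x hx => ?_
    have hx' := interior_subset hx
    have hx0 : 0 < x := hz.trans_le hx'.1
    rw [(hderiv x hx0).deriv]
    have h1 := hd.near x ⟨hx0, hx'.2⟩ 1 (Finset.mem_Icc.2 ⟨le_rfl, hk⟩)
    have h2 : x ^ a₁ = x ^ (a₁ - 1) * x := by
      rw [← Real.rpow_add_one hx0.ne', sub_add_cancel]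
    have h3 : 0 < x ^ (a₁ - 1) := Real.rpow_pos_of_pos hx0 _
    have h4 : 0 ≤ a₁ * Φ x + x ^ (2 * 1) * radialDeriv 1 Φ x := by
      have := neg_abs_le (radialDeriv 1 Φ x)
      have : 0 < x ^ (2 * 1) := by positivity
      nlinarith
    rw [h2]
    have := mul_nonneg h3.le h4
    linear_combination this
  have hl0 : 0 < l := by linarith
  have hzl : z ≤ l * z := le_mul_of_one_le_left hz.le hl
  have := hmono ⟨le_rfl, hzl.trans hlz⟩ ⟨hzl, hlz⟩ hzl
  simp only at this
  rw [Real.mul_rpow hl0.le hz.le] at this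
  have hza : 0 < z ^ a₁ := Real.rpow_pos_of_pos hz _
  refine le_of_mul_le_mul_left ?_ hza
  linear_combination this

variable {F : Type*} [NormedAddCommGroup F] [InnerProductSpace ℝ F]

/-- The `k`-th derivative has a fixed sign along the segment, so the step may be shortened to `η =
min v ‖y‖`. On the shorter segment radii are at most `(k + 1) ‖y‖`, and doubling compares `Φ` there
with `Φ ‖y‖`. -/
theorem le_fwdDiff_of_cone {k : ℕ} (hk : 1 ≤ k) {Φ : ℝ → ℝ} {z₁ a₁ a₂ δ₁ γ v : ℝ}
    (hnn : ∀ z, 0 < z → 0 ≤ Φ z) (hanti : AntitoneOn Φ (Ioi 0)) (hδ : 0 < δ₁)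
    (hd : DerivUpperBounds k Φ z₁ a₁ a₂) (hl : DerivLowerBound k Φ z₁ δ₁) (hγ : 0 < γ)
    (hγ1 : γ < 1)
    (hsum : ∑ j ∈ Finset.range (k + 1),
      (radialCoeff k j : ℝ) * (a₁ * (1 - γ ^ (2 * j - k))) ≤ δ₁ / 2)
    {e y : F} (he : ‖e‖ = 1) (hy : y ≠ 0) (hye : γ * ‖y‖ ≤ inner ℝ y e) (hv : 0 < v)
    (hyv : ‖y‖ + k * v ≤ z₁) (hyk : (k + 1) * ‖y‖ ≤ z₁) :
    δ₁ / 2 / ((k + 1) ^ k * (k + 1) ^ a₁) * ((min v ‖y‖ / ‖y‖) ^ k * Φ ‖y‖) ≤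
      (-1) ^ k * (fwdDiff (v • e))^[k] (fun x => Φ ‖x‖) y := by
  have hy0 : 0 < ‖y‖ := norm_pos_iff.2 hy
  set η := min v ‖y‖ with hη
  have hη0 : 0 < η := lt_min hv hy0
  have hinner : ∀ x : ℝ, inner ℝ (y + x • e) e = inner ℝ y e + x := fun x => by
    rw [inner_add_left, real_inner_smul_left, real_inner_self_eq_norm_sq, he]
    ring
  have hnorm_le : ∀ x : ℝ, 0 ≤ x → ‖y + x • e‖ ≤ ‖y‖ + x := fun x hx => by
    refine (norm_add_le _ _).trans_eq ?_
    rw [norm_smul, he, mul_one, Real.norm_of_nonneg hx]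
  -- Moving by `x` along `e` raises the inner product by `x` and the norm by at most `x`; `γ < 1`
  -- keeps the point in the cone.
  have hcone : ∀ x : ℝ, 0 ≤ x → γ * ‖y + x • e‖ ≤ inner ℝ (y + x • e) e := fun x hx => by
    rw [hinner]
    nlinarith [hnorm_le x hx]
  have hne : ∀ x : ℝ, 0 ≤ x → y + x • e ≠ 0 := fun x hx h0 => by
    have h1 := hinner x
    rw [h0, inner_zero_left] at h1
    have : 0 < γ * ‖y‖ := by positivity
    linarith
  have hkey : ∀ x ∈ Icc (0 : ℝ) (k * v), δ₁ / 2 * (Φ ‖y + x • e‖ / ‖y + x • e‖ ^ k) ≤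
      (-1) ^ k * radialPoly Φ k ‖y + x • e‖ (inner ℝ (y + x • e) e) (‖e‖ ^ 2) := by
    intro x hx
    have hpos : 0 < ‖y + x • e‖ := norm_pos_iff.2 (hne x hx.1)
    rw [he, one_pow]
    refine le_radialPoly_of_cone hk hd hl hγ hsum ⟨hpos, ?_⟩ (hnn _ hpos) (hcone x hx.1) ?_
    · linarith [hnorm_le x hx.1, hx.2]
    · simpa [he] using real_inner_le_norm (y + x • e) e
  have hchain := (derivChain_radialPoly hd.contDiffOn (z := y) (h := e) (a := 0) (b := k * v)
    fun x hx => hne x hx.1).const_mul ((-1) ^ k)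
  have hmono := hchain.iterate_fwdDiff_mono hη0.le (min_le_left v ‖y‖) (by simp) fun x hx => by
    have hpos : 0 < ‖y + x • e‖ := norm_pos_iff.2 (hne x hx.1)
    have h0 := hnn _ hpos
    exact le_trans (by positivity) (hkey x hx)
  have hkη : (k : ℝ) * η ≤ k * v := by
    gcongr
    exact min_le_left _ _
  set R := ‖y‖ + k * η with hR
  have hR0 : 0 < R := by positivity
  have hRk : R ≤ (k + 1) * ‖y‖ := by
    have : (k : ℝ) * η ≤ k * ‖y‖ := by
      gcongr
      exact min_le_right _ _
    linarith
  have hlow := (hchain.mono le_rfl hkη).le_iterate_fwdDiff (c := δ₁ / 2 * (Φ R / R ^ k)) hη0.le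
    (by simp) fun x hx => by
      refine le_trans ?_ (hkey x ⟨hx.1, hx.2.trans hkη⟩)
      have hpos : 0 < ‖y + x • e‖ := norm_pos_iff.2 (hne x hx.1)
      have hle : ‖y + x • e‖ ≤ R := by linarith [hnorm_le x hx.1, hx.2]
      have := hanti hpos hR0 hle
      have := hnn R hR0
      have := hnn _ hpos
      gcongr
  have hfin := hlow.trans hmono
  rw [iterate_fwdDiff_smul]
  simp only [fwdDiff_iterate_const_mul, radialPoly_zero] at hfin
  refine le_trans ?_ hfin
  have hk1 : (0 : ℝ) < k + 1 := by positivity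
  have hky : 0 < (k + 1) * ‖y‖ := by positivity
  have hdoub := le_mul_rpow_of_near hk hd (l := k + 1) (by linarith [Nat.cast_nonneg (α := ℝ) k])
    hy0 hyk
  have hΦR : Φ ((k + 1) * ‖y‖) ≤ Φ R := hanti hR0 hky hRk
  have hka : 0 < ((k : ℝ) + 1) ^ a₁ := Real.rpow_pos_of_pos hk1 _
  have hΦk := hnn _ hky
  have hΦR0 := hnn _ hR0
  calc δ₁ / 2 / ((k + 1) ^ k * (k + 1) ^ a₁) * ((η / ‖y‖) ^ k * Φ ‖y‖)
      ≤ δ₁ / 2 / ((k + 1) ^ k * (k + 1) ^ a₁) *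
        ((η / ‖y‖) ^ k * ((k + 1) ^ a₁ * Φ ((k + 1) * ‖y‖))) := by gcongr
    _ = δ₁ / 2 * (Φ ((k + 1) * ‖y‖) / ((k + 1) * ‖y‖) ^ k) * η ^ k := by
      rw [div_pow, mul_pow]
      field_simp
    _ ≤ _ := by gcongr

end LowerPointwise

/-! ### The lower bound of the kernel by `Ω_φ` on a cone. -/

section LowerKernel

/-- The open cone of directions close to `e`. -/
def coneAround {n : ℕ} (e : EuclideanSpace ℝ (Fin n)) (γ : ℝ) : Set (EuclideanSpace ℝ (Fin n)) :=
  {y | γ * ‖y‖ < inner ℝ y e}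

variable {n : ℕ} {e : EuclideanSpace ℝ (Fin n)} {γ : ℝ}

theorem isOpen_coneAround : IsOpen (coneAround e γ) :=
  isOpen_lt (by fun_prop) (by fun_prop)

theorem smul_mem_coneAround {r : ℝ} (hr : 0 < r) (x : EuclideanSpace ℝ (Fin n)) :
    r • x ∈ coneAround e γ ↔ x ∈ coneAround e γ := by
  change γ * ‖r • x‖ < inner ℝ (r • x) e ↔ γ * ‖x‖ < inner ℝ x e
  rw [norm_smul, Real.norm_of_nonneg hr.le, real_inner_smul_left, mul_left_comm,
    mul_lt_mul_iff_right₀ hr]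

theorem ne_zero_of_mem_coneAround {x : EuclideanSpace ℝ (Fin n)} (hx : x ∈ coneAround e γ) :
    x ≠ 0 := by
  rintro rfl
  have h : γ * ‖(0 : EuclideanSpace ℝ (Fin n))‖ < inner ℝ (0 : EuclideanSpace ℝ (Fin n)) e := hx
  simp at h

theorem volume_coneAround_pos (he : ‖e‖ = 1) (hγ : γ < 1) :
    0 < volume (coneAround e γ ∩ Metric.closedBall 0 1) := by
  have ho : IsOpen (coneAround e γ ∩ Metric.ball 0 1) := isOpen_coneAround.inter Metric.isOpen_ball
  refine (ho.measure_pos volume ⟨(1 / 2 : ℝ) • e, ?_, ?_⟩).trans_le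
    (measure_mono (inter_subset_inter_right _ Metric.ball_subset_closedBall))
  · rw [smul_mem_coneAround (by norm_num)]
    change γ * ‖e‖ < inner ℝ e e
    rw [real_inner_self_eq_norm_sq, he]
    linarith
  · rw [mem_ball_zero_iff, norm_smul, he]
    norm_num

theorem exists_OmegaPhi_le_fwdDiff (k n : ℕ) (hk : 1 ≤ k) (hn : 1 ≤ n) {z₁ a₁ δ₁ T : ℝ}
    (hz₁ : 0 < z₁) (hδ : 0 < δ₁) (hT : 0 < T) : ∃ c ε ρ γ : ℝ, 0 < c ∧ 0 < ε ∧ ε ≤ 1 ∧ 0 < ρ ∧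
      γ < 1 ∧ ∀ (a₂ : ℝ) (Φ : ℝ → ℝ), (∀ z, 0 < z → 0 ≤ Φ z) → AntitoneOn Φ (Ioi 0) →
      DerivUpperBounds k Φ z₁ a₁ a₂ → DerivLowerBound k Φ z₁ δ₁ →
      ∀ e : EuclideanSpace ℝ (Fin n), ‖e‖ = 1 → ∀ t ∈ Ioo 0 T, ∀ y ∈ coneAround e γ, ‖y‖ ≤ ρ →
        c * OmegaPhi n k Φ t (radialVol y) ≤
          (-1) ^ k * (fwdDiff ((ε * t ^ (1 / (n : ℝ))) • e))^[k] (fun x => Φ ‖x‖) y := by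
  obtain ⟨γ, hγ, hγ1, hsum⟩ := exists_cone_aperture k (a₁ := a₁) hδ
  have hV := ballVol_pos n
  set b := ballVol n ^ ((k : ℝ) / n) with hb
  have hb0 : 0 < b := Real.rpow_pos_of_pos hV _
  set τ := T ^ (1 / (n : ℝ)) with hτ
  have hτ0 : 0 < τ := Real.rpow_pos_of_pos hT _
  have hk0 : (0 : ℝ) < k := by exact_mod_cast hk
  -- Shortening the step by `ε` makes `k` steps cover at most `z₁ / 2` for every `t < T`; the radius
  -- `z₁ / (2 * (k + 1))` below keeps `(k + 1) ‖y‖` within `z₁ / 2`.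
  set ε := min 1 (z₁ / (2 * k * τ)) with hε
  have hε0 : 0 < ε := lt_min one_pos (by positivity)
  have hk1 : (0 : ℝ) < k + 1 := by positivity
  set c₀ := δ₁ / 2 / (((k : ℝ) + 1) ^ k * ((k : ℝ) + 1) ^ a₁) with hc₀
  have hc₀0 : 0 < c₀ := by
    have := Real.rpow_pos_of_pos hk1 a₁
    positivity
  refine ⟨c₀ * min 1 (ε ^ k * b), ε, z₁ / (2 * (k + 1)), γ, by positivity, hε0, min_le_left _ _,
    by positivity, hγ1, fun a₂ Φ hnn hanti hd hl e he t ht y hye hyρ => ?_⟩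
  set s := t ^ (1 / (n : ℝ)) with hs
  have hs0 : 0 < s := Real.rpow_pos_of_pos ht.1 _
  have hsτ : s ≤ τ := Real.rpow_le_rpow ht.1.le ht.2.le (by positivity)
  have hy0 : y ≠ 0 := ne_zero_of_mem_coneAround hye
  have hny : 0 < ‖y‖ := norm_pos_iff.2 hy0
  have hεs : k * (ε * s) ≤ z₁ / 2 := by
    calc k * (ε * s) ≤ k * (z₁ / (2 * k * τ) * τ) := by
          gcongr
          exact min_le_right _ _
      _ = z₁ / 2 := by field_simp
  have hyk : (k + 1) * ‖y‖ ≤ z₁ / 2 := by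
    calc (k + 1) * ‖y‖ ≤ (k + 1) * (z₁ / (2 * (k + 1))) := by gcongr
      _ = z₁ / 2 := by field_simp
  have hyz : ‖y‖ ≤ z₁ / 2 := by nlinarith
  have hmain := le_fwdDiff_of_cone hk hnn hanti hδ hd hl hγ hγ1 hsum he hy0 (le_of_lt hye)
    (mul_pos hε0 hs0) (by linarith) (by linarith)
  refine le_trans ?_ hmain
  have hΦ0 := hnn _ hny
  rw [← hc₀, mul_assoc, OmegaPhi, phi_radialVol hn, radialVol_div_rpow hn k y ht.1, ← hb, ← hs]
  refine mul_le_mul_of_nonneg_left ?_ hc₀0.le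
  have hden : 0 < 1 + b * (‖y‖ / s) ^ k := by positivity
  rw [← mul_div_assoc, div_le_iff₀ hden, mul_right_comm]
  refine mul_le_mul_of_nonneg_right ?_ hΦ0
  -- For small `‖y‖` the quotient `min (ε s) ‖y‖ / ‖y‖` is `1`; otherwise its `k`-th power times the
  -- growing part of the denominator of `Ω_φ` is exactly `ε^k b`.
  rcases le_total ‖y‖ (ε * s) with h | h
  · rw [min_eq_right h, div_self hny.ne', one_pow, one_mul]
    have : 0 < b * (‖y‖ / s) ^ k := by positivity
    linarith [min_le_left 1 (ε ^ k * b)]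
  · rw [min_eq_left h]
    have h1 : (ε * s / ‖y‖) ^ k * (b * (‖y‖ / s) ^ k) = ε ^ k * b := by
      rw [mul_left_comm, ← mul_pow, mul_comm b]
      congr 2
      field_simp
    have h2 : 0 < (ε * s / ‖y‖) ^ k := by positivity
    linarith [min_le_right 1 (ε ^ k * b)]

end LowerKernel

/-! ### Hölder's inequality on `(0, T)`, and finiteness. -/

section AssocNorm

variable {n : ℕ} {E : RISpace (volume : Measure (EuclideanSpace ℝ (Fin n)))} {T : ℝ}

/-- A continuous decreasing function extended by zero is its own rearrangement, so integrals over
`(0, T)` are those in the definition of `assocNorm`. -/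
theorem setLIntegral_ofReal_mul_eq {ψ : ℝ → ℝ} (hψ : AntitoneOn ψ (Ioo 0 T))
    (hc : ContinuousOn ψ (Ioo 0 T)) (χ : ℝ → ℝ≥0∞) :
    ∫⁻ τ in Ioo 0 T, ENNReal.ofReal (ψ τ) * χ τ = ∫⁻ τ in Ioi (0 : ℝ),
      rearr volPos ((Ioo 0 T).indicator fun τ => ENNReal.ofReal (ψ τ)) τ * χ τ := by
  rw [← lintegral_indicator measurableSet_Ioo, ← lintegral_indicator measurableSet_Ioi]
  refine lintegral_congr fun τ => ?_
  by_cases hτ : 0 < τ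
  · rw [indicator_of_mem (show τ ∈ Ioi 0 from hτ), rearr_volPos_indicator_eq hψ hc hτ]
    exact indicator_mul_left (Ioo 0 T) (fun τ => ENNReal.ofReal (ψ τ)) χ
  · rw [indicator_of_notMem (show τ ∉ Ioi 0 from hτ),
      indicator_of_notMem (show τ ∉ Ioo 0 T from fun h => hτ h.1)]

theorem setLIntegral_mul_rearr_le_assocNormOn (hn : 1 ≤ n) {ψ : ℝ → ℝ}
    (hψ : AntitoneOn ψ (Ioo 0 T)) (hc : ContinuousOn ψ (Ioo 0 T))
    {f : EuclideanSpace ℝ (Fin n) → ℝ≥0∞} (hf : AEMeasurable f volume) {N : ℝ≥0} (hN : N ≠ 0)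
    (hfN : E.rho f ≤ N) :
    ∫⁻ τ in Ioo 0 T, ENNReal.ofReal (ψ τ) * rearr volume f τ ≤ N * E.assocNormOn T ψ := by
  rw [setLIntegral_ofReal_mul_eq hψ hc]
  have := lintegral_rearr_mul_rearr_le (E := E)
    (h := (Ioo 0 T).indicator fun τ => ENNReal.ofReal (ψ τ))
    (rearr_antitone (μ := volume) f).measurable.aemeasurable hN ((luxNorm_rearr_le hn hf).trans hfN)
  rwa [rearr_volPos_rearr] at this

theorem IsStandardProfile.antitoneOn_OmegaPhi {Φ : ℝ → ℝ} (hΦ : IsStandardProfile n Φ) (k : ℕ)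
    {t : ℝ} (ht : 0 < t) : AntitoneOn (OmegaPhi n k Φ t) (Ioi 0) := by
  intro x hx y hy hxy
  have hx0 : 0 < x := hx
  have := hΦ.phi_nonneg hy
  have := hΦ.phi_nonneg hx
  have := hΦ.antitoneOn_phi hx hy hxy
  unfold OmegaPhi
  gcongr

theorem IsStandardProfile.OmegaPhi_nonneg {Φ : ℝ → ℝ} (hΦ : IsStandardProfile n Φ) (k : ℕ)
    {t τ : ℝ} (ht : 0 < t) (hτ : 0 < τ) : 0 ≤ OmegaPhi n k Φ t τ := by
  have := hΦ.phi_nonneg hτ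
  unfold OmegaPhi
  positivity

theorem IsStandardProfile.continuousOn_OmegaPhi {Φ : ℝ → ℝ} (hΦ : IsStandardProfile n Φ) (k : ℕ)
    {t : ℝ} (ht : 0 < t) : ContinuousOn (OmegaPhi n k Φ t) (Ioi 0) := by
  refine hΦ.continuousOn_phi.div ?_ fun τ hτ => ?_
  · refine continuousOn_const.add (ContinuousOn.rpow_const (by fun_prop) fun τ hτ => ?_)
    exact Or.inl (div_pos hτ ht).ne'
  · have hτ0 : 0 < τ := hτ
    positivity

/-- The role of the assumption `φ ∈ Ẽ'(0, T)`: potentials of elements of `E` converge absolutely. -/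
theorem IsStandardProfile.lintegral_phi_mul_rearr_lt_top {Φ : ℝ → ℝ} (hΦ : IsStandardProfile n Φ)
    (hn : 1 ≤ n) (hT : 0 < T) (hfin : E.assocNormOn T (phi n Φ) < ∞)
    {f : EuclideanSpace ℝ (Fin n) → ℝ≥0∞} (hf : AEMeasurable f volume) (hfE : E.rho f < ∞) :
    ∫⁻ τ in Ioi (0 : ℝ), ENNReal.ofReal (phi n Φ τ) * rearr volume f τ < ∞ := by
  have hN := ENNReal.coe_toNNReal hfE.ne
  refine (hΦ.lintegral_phi_mul_le hn hT ((rearr_antitone _).antitoneOn _)).trans_lt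
    (ENNReal.mul_lt_top ENNReal.ofReal_lt_top ?_)
  refine (setLIntegral_mul_rearr_le_assocNormOn (E := E) hn
    (hΦ.antitoneOn_phi.mono Ioo_subset_Ioi_self) (hΦ.continuousOn_phi.mono Ioo_subset_Ioi_self)
    hf (N := (E.rho f).toNNReal + 1) (by positivity) ?_).trans_lt
    (ENNReal.mul_lt_top ENNReal.coe_lt_top hfin)
  rw [ENNReal.coe_add, hN]
  exact le_self_add

/-- An infinite value at `τ` would make the radial function infinite on a punctured ball of volume
`τ`, against the local integrability axiom `lintegral_le`. Hence `σ` can be converted to real values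
without loss. -/
theorem lt_top_of_luxNormOn_lt_top (hn : 1 ≤ n) {σ : ℝ → ℝ≥0∞} (hσ : AntitoneOn σ (Ioo 0 T))
    (hfin : E.luxNormOn T σ < ∞) {τ : ℝ} (hτ : τ ∈ Ioo 0 T) : σ τ < ∞ := by
  by_contra htop
  rw [not_lt, top_le_iff] at htop
  have hanti := antitoneOn_indicator_Ioo hσ
  set B := radialVol (n := n) ⁻¹' Ioo 0 τ with hB
  have hBm : MeasurableSet B := measurable_radialVol measurableSet_Ioo
  have hvol : volume B = ENNReal.ofReal τ := by
    rw [hB, (measurePreserving_radialVol hn).measure_preimage measurableSet_Ioo.nullMeasurableSet,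
      volPos, Measure.restrict_apply measurableSet_Ioo,
      inter_eq_left.2 Ioo_subset_Ioi_self, Real.volume_Ioo, sub_zero]
  obtain ⟨c, hc⟩ := E.lintegral_le B hBm (by rw [hvol]; exact ENNReal.ofReal_lt_top)
  have h1 := (hc _ (aemeasurable_rearr_radialVol ((Ioo 0 T).indicator σ) _
    measurable_radialVol)).trans_lt (ENNReal.mul_lt_top ENNReal.coe_lt_top hfin)
  rw [setLIntegral_congr_fun (g := fun _ => ∞) hBm fun x hx => ?_, setLIntegral_const, hvol,
    ENNReal.top_mul (ENNReal.ofReal_pos.2 hτ.1).ne'] at h1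
  · exact lt_irrefl _ h1
  · have := le_rearr_volPos hanti hx.1 hx.2
    rwa [indicator_of_mem hτ, htop, top_le_iff] at this

end AssocNorm

/-! ### The extremal function and the lower bound for the modulus. -/

section LowerBound

variable {n : ℕ}

theorem lintegral_coneAround_radialVol (hn : 1 ≤ n) (e : EuclideanSpace ℝ (Fin n)) (γ : ℝ)
    {w : ℝ → ℝ≥0∞} (hw : AEMeasurable w volPos) :
    ∫⁻ y in coneAround e γ, w (radialVol y) =
      volume (coneAround e γ ∩ Metric.closedBall 0 1) / ENNReal.ofReal (ballVol n) *
        ∫⁻ τ in Ioi (0 : ℝ), w τ := by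
  have hmap := map_radialVol_restrict_cone hn (C := coneAround e γ)
    fun r hr x => smul_mem_coneAround hr x
  rw [← lintegral_map' (f := w) (g := radialVol) (by rw [hmap]; exact hw.smul_measure _)
    measurable_radialVol.aemeasurable, hmap, lintegral_smul_measure, smul_eq_mul]
  rfl

/-- The kernel is even, so at the origin the step `-h` turns `Δ_h^k G` into the convolution kernel
in `y`; the constant sign moves the absolute value inside the integral. -/
theorem enorm_fwdDiff_potential_eq {k : ℕ} {Φ : ℝ → ℝ} {F : EuclideanSpace ℝ (Fin n) → ℝ}
    (hint : ∀ x, Integrable (fun y => (Φ ‖x - y‖ : ℂ) * (F y : ℂ)) volume)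
    (h : EuclideanSpace ℝ (Fin n))
    (hpos : ∀ y, 0 ≤ (-1) ^ k * (fwdDiff h)^[k] (fun x => Φ ‖x‖) y * F y) :
    ‖(fwdDiff (-h))^[k] (potential Φ fun y => (F y : ℂ)) 0‖ₑ =
      ∫⁻ y, ENNReal.ofReal ((-1) ^ k * (fwdDiff h)^[k] (fun x => Φ ‖x‖) y * F y) := by
  have heven : ∀ y, (fwdDiff (-h))^[k] (fun x => Φ ‖x‖) (0 - y) =
      (fwdDiff h)^[k] (fun x => Φ ‖x‖) y := fun y => by
    rw [fwdDiff_iter_eq_sum_shift, fwdDiff_iter_eq_sum_shift]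
    refine Finset.sum_congr rfl fun j _ => ?_
    rw [zero_sub, smul_neg, ← neg_add, norm_neg]
  have hI := integrable_fwdDiff_potential hint k (-h) 0
  rw [iterate_fwdDiff_potential hint]
  simp only [heven, ← Complex.ofReal_mul] at hI ⊢
  have hI' : Integrable (fun y => (-1) ^ k * (fwdDiff h)^[k] (fun x => Φ ‖x‖) y * F y) volume := by
    simp only [mul_assoc]
    have h0 : Integrable (fun y => (fwdDiff h)^[k] (fun x => Φ ‖x‖) y * F y) volume := by
      simpa using hI.re
    exact h0.const_mul _
  rw [← ofReal_integral_eq_lintegral_ofReal hI' (Filter.Eventually.of_forall hpos),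
    integral_complex_ofReal, ← ofReal_norm, Complex.norm_real]
  congr 1
  rw [← abs_of_nonneg (a := ∫ y, (-1) ^ k * (fwdDiff h)^[k] (fun x => Φ ‖x‖) y * F y)
    (integral_nonneg hpos)]
  simp only [mul_assoc]
  rw [integral_const_mul, abs_mul, abs_pow, abs_neg, abs_one, one_pow, one_mul, Real.norm_eq_abs]

theorem exists_le_modulus (k n : ℕ) (hk : 1 ≤ k) (hn : 1 ≤ n) {z₁ a₁ δ₁ T : ℝ}
    (hz₁ : 0 < z₁) (hδ : 0 < δ₁) (hT : 0 < T) : ∃ c : ℝ, 0 < c ∧ ∀ (a₂ : ℝ)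
      (E : RISpace (volume : Measure (EuclideanSpace ℝ (Fin n)))) (Φ : ℝ → ℝ),
      IsStandardProfile n Φ → E.assocNormOn T (phi n Φ) < ∞ → DerivUpperBounds k Φ z₁ a₁ a₂ →
      DerivLowerBound k Φ z₁ δ₁ →
      ∀ σ : ℝ → ℝ≥0∞, AntitoneOn σ (Ioo 0 T) → E.luxNormOn T σ < ∞ →
        ∃ f : EuclideanSpace ℝ (Fin n) → ℂ, AEMeasurable f volume ∧
          E.rho (fun x => ‖f x‖ₑ) ≤ E.luxNormOn T σ ∧
          (∀ τ : ℝ, 0 < τ → rearr volume (fun x => ‖f x‖ₑ) τ ≤ (Ioo 0 T).indicator σ τ) ∧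
          ∀ t ∈ Ioo 0 T, ENNReal.ofReal c *
            ∫⁻ τ in Ioo 0 T, ENNReal.ofReal (OmegaPhi n k Φ t τ) * σ τ ≤
              modulus k (potential Φ f) (t ^ (1 / (n : ℝ))) := by
  obtain ⟨c, ε, ρ, γ, hc, hε, hε1, hρ, hγ1, hker⟩ :=
    exists_OmegaPhi_le_fwdDiff k n hk hn (a₁ := a₁) hz₁ hδ hT
  have : Nonempty (Fin n) := ⟨⟨0, hn⟩⟩
  obtain ⟨e, he⟩ := exists_norm_eq (EuclideanSpace ℝ (Fin n)) (zero_le_one (α := ℝ))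
  have hV := ballVol_pos n
  set κ := volume (coneAround e γ ∩ Metric.closedBall 0 1) / ENNReal.ofReal (ballVol n) with hκ
  have hκ0 : κ ≠ 0 :=
    (ENNReal.div_pos (volume_coneAround_pos he hγ1).ne' ENNReal.ofReal_ne_top).ne'
  have hκtop : κ ≠ ∞ := ENNReal.div_ne_top ((measure_mono inter_subset_right).trans_lt
    (isCompact_closedBall _ _).measure_lt_top).ne (ENNReal.ofReal_pos.2 hV).ne'
  set T₁ := ballVol n * ρ ^ n with hT₁
  have hT₁0 : 0 < T₁ := by positivity
  set l := max 1 (T / T₁) with hl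
  have hl1 : 1 ≤ l := le_max_left _ _
  have hl0 : 0 < l := by linarith
  have hTl : T ≤ l * T₁ := by
    rw [← div_le_iff₀ hT₁0]
    exact le_max_right _ _
  refine ⟨c * κ.toReal / l, by have := ENNReal.toReal_pos hκ0 hκtop; positivity,
    fun a₂ E Φ hΦ hfin hd hlow σ hσ hσE => ?_⟩
  have hσanti := antitoneOn_indicator_Ioo hσ
  set σ' := (Ioo 0 T).indicator σ with hσ'
  have hσm := aemeasurable_volPos_of_antitoneOn hσanti
  have hσtop : ∀ τ, σ' τ ≠ ∞ := fun τ => by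
    by_cases hτ : τ ∈ Ioo 0 T
    · rw [hσ', indicator_of_mem hτ]
      exact (lt_top_of_luxNormOn_lt_top hn hσ hσE hτ).ne
    · rw [hσ', indicator_of_notMem hτ]
      exact ENNReal.zero_ne_top
  have hp := measurePreserving_radialVol hn
  set A := coneAround e γ ∩ radialVol ⁻¹' Iic T₁ with hA
  have hAm : MeasurableSet A :=
    isOpen_coneAround.measurableSet.inter (measurable_radialVol measurableSet_Iic)
  have hσrm : AEMeasurable (fun y => σ' (radialVol y))
      (volume : Measure (EuclideanSpace ℝ (Fin n))) :=
    hσm.comp_quasiMeasurePreserving hp.quasiMeasurePreserving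
  -- The extremal function is built before `t` is introduced, so one `f` serves all `t`.
  set F : EuclideanSpace ℝ (Fin n) → ℝ :=
    fun y => A.indicator (fun y => (σ' (radialVol y)).toReal) y
    with hF
  have hF0 : ∀ y, 0 ≤ F y := fun y => indicator_nonneg (fun _ _ => ENNReal.toReal_nonneg) y
  have hFm : AEMeasurable F volume := hσrm.ennreal_toReal.indicator hAm
  have hfm : AEMeasurable (fun y => (F y : ℂ)) volume :=
    Complex.measurable_ofReal.comp_aemeasurable hFm
  have hfn : ∀ y, ‖(F y : ℂ)‖ₑ ≤ σ' (radialVol y) := fun y => by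
    rw [← ofReal_norm, Complex.norm_real, Real.norm_of_nonneg (hF0 y), hF]
    by_cases hy : y ∈ A
    · simp only [indicator_of_mem hy]
      exact ENNReal.ofReal_toReal_le
    · simp only [indicator_of_notMem hy, ENNReal.ofReal_zero]
      exact zero_le
  have hre : ∀ τ, rearr volume (fun y => ‖(F y : ℂ)‖ₑ) τ ≤ rearr volPos σ' τ := fun τ => by
    rw [← rearr_comp hp hσm]
    exact rearr_mono_ae (Filter.Eventually.of_forall hfn) τ
  have hrho : E.rho (fun y => ‖(F y : ℂ)‖ₑ) ≤ E.luxNormOn T σ :=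
    rho_le_luxNorm hn hfm.enorm fun τ _ => hre τ
  refine ⟨fun y => (F y : ℂ), hfm, hrho, fun τ hτ => (hre τ).trans (rearr_volPos_le hσanti hτ),
    fun t ht => ?_⟩
  have hint := hΦ.integrable_potential hn hfm
    (hΦ.lintegral_phi_mul_rearr_lt_top hn hT hfin hfm.enorm (hrho.trans_lt hσE))
  set s := t ^ (1 / (n : ℝ)) with hs
  have hs0 : 0 < s := Real.rpow_pos_of_pos ht.1 _
  set R := fun y => (-1) ^ k * (fwdDiff ((ε * s) • e))^[k] (fun x => Φ ‖x‖) y with hR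
  have hAρ : ∀ y ∈ A, ‖y‖ ≤ ρ := fun y hy => by
    have h1 : ballVol n * ‖y‖ ^ n ≤ ballVol n * ρ ^ n := hy.2
    exact (pow_le_pow_iff_left₀ (norm_nonneg y) hρ.le (by omega)).1 (le_of_mul_le_mul_left h1 hV)
  have hRA : ∀ y ∈ A, c * OmegaPhi n k Φ t (radialVol y) ≤ R y := fun y hy =>
    hker a₂ Φ hΦ.nonneg hΦ.antitoneOn hd hlow e he t ht y hy.1 (hAρ y hy)
  have hΩ0 : ∀ y ∈ A, 0 ≤ OmegaPhi n k Φ t (radialVol y) := fun y hy =>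
    hΦ.OmegaPhi_nonneg k ht.1 (radialVol_pos (ne_zero_of_mem_coneAround hy.1))
  have hRF : ∀ y, 0 ≤ R y * F y := fun y => by
    by_cases hy : y ∈ A
    · exact mul_nonneg ((mul_nonneg hc.le (hΩ0 y hy)).trans (hRA y hy)) (hF0 y)
    · simp [hF, indicator_of_notMem hy]
  have hmod : ∫⁻ y, ENNReal.ofReal (R y * F y) ≤ modulus k (potential Φ fun y => (F y : ℂ)) s := by
    rw [← enorm_fwdDiff_potential_eq hint _ hRF]
    refine le_iSup_of_le (-((ε * s) • e)) (le_iSup_of_le ?_ (le_iSup_of_le 0 le_rfl))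
    rw [norm_neg, norm_smul, he, mul_one, Real.norm_of_nonneg (by positivity)]
    exact mul_le_of_le_one_left hs0.le hε1
  refine le_trans ?_ hmod
  have hΩanti : AntitoneOn (fun τ => ENNReal.ofReal (OmegaPhi n k Φ t τ) * σ' τ) (Ioi 0) :=
    fun x hx y hy hxy => mul_le_mul' (ENNReal.ofReal_le_ofReal
      (hΦ.antitoneOn_OmegaPhi k ht.1 hx hy hxy)) (hσanti hx hy hxy)
  have hΩm := aemeasurable_volPos_of_antitoneOn hΩanti
  set I := ∫⁻ τ in Ioi (0 : ℝ), (Iic T₁).indicator 1 τ *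
    (ENNReal.ofReal (OmegaPhi n k Φ t τ) * σ' τ) with hI
  have hdil : ∫⁻ τ in Ioo 0 T, ENNReal.ofReal (OmegaPhi n k Φ t τ) * σ τ ≤
      ENNReal.ofReal l * I := by
    refine le_trans ?_ (lintegral_comp_div_mul_le hΩanti hl1)
    rw [← lintegral_indicator measurableSet_Ioo, ← lintegral_indicator measurableSet_Ioi]
    refine lintegral_mono fun τ => ?_
    by_cases hτ : τ ∈ Ioo 0 T
    · have h1 : τ / l ∈ Iic T₁ := by
        rw [mem_Iic, div_le_iff₀ hl0, mul_comm]
        exact hτ.2.le.trans hTl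
      rw [indicator_of_mem hτ, indicator_of_mem (show τ ∈ Ioi 0 from hτ.1), indicator_of_mem h1,
        hσ', indicator_of_mem hτ, Pi.one_apply, one_mul]
    · rw [indicator_of_notMem hτ]
      exact zero_le
  have hone : AEMeasurable ((Iic T₁).indicator (1 : ℝ → ℝ≥0∞)) volPos :=
    (measurable_one.indicator measurableSet_Iic).aemeasurable
  have hlower : ENNReal.ofReal c * (κ * I) ≤ ∫⁻ y, ENNReal.ofReal (R y * F y) := by
    have hcone := lintegral_coneAround_radialVol hn e γ (w := fun τ => (Iic T₁).indicator 1 τ *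
      (ENNReal.ofReal (OmegaPhi n k Φ t τ) * σ' τ)) (hone.mul hΩm)
    rw [hI, hκ, ← hcone,
      ← lintegral_const_mul' _ _ ENNReal.ofReal_ne_top,
      ← lintegral_indicator isOpen_coneAround.measurableSet]
    refine lintegral_mono fun y => ?_
    by_cases hyC : y ∈ coneAround e γ
    · rw [indicator_of_mem hyC]
      by_cases hyT : radialVol y ∈ Iic T₁
      · have hy : y ∈ A := ⟨hyC, hyT⟩
        simp only [indicator_of_mem hyT, Pi.one_apply, one_mul, hF,
          indicator_of_mem hy]
        rw [ENNReal.ofReal_mul ((mul_nonneg hc.le (hΩ0 y hy)).trans (hRA y hy)),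
          ENNReal.ofReal_toReal (hσtop _), ← mul_assoc, ← ENNReal.ofReal_mul hc.le]
        gcongr
        exact hRA y hy
      · simp [indicator_of_notMem hyT]
    · rw [indicator_of_notMem hyC]
      exact zero_le
  calc ENNReal.ofReal (c * κ.toReal / l) *
        ∫⁻ τ in Ioo 0 T, ENNReal.ofReal (OmegaPhi n k Φ t τ) * σ τ
      ≤ ENNReal.ofReal (c * κ.toReal / l) * (ENNReal.ofReal l * I) := by gcongr
    _ = ENNReal.ofReal c * (κ * I) := by
        rw [← mul_assoc, ← ENNReal.ofReal_mul (by positivity), div_mul_cancel₀ _ hl0.ne',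
          ENNReal.ofReal_mul hc.le, ENNReal.ofReal_toReal hκtop, mul_assoc]
    _ ≤ _ := hlower

end LowerBound

/-! ### From single potentials to the uniform majorant. -/

section Majorant

variable {n : ℕ} {E : RISpace (volume : Measure (EuclideanSpace ℝ (Fin n)))} {Φ : ℝ → ℝ} {T : ℝ}

/-- Used because the infimum in `potentialNorm` need not be attained: a potential of norm at most
`1` has a representing `f` of norm below any `N > 1`. -/
theorem ENNReal.le_of_forall_one_lt_le_mul {a b : ℝ≥0∞}
    (h : ∀ N : ℝ≥0, 1 < N → a ≤ N * b) : a ≤ b := by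
  by_contra! hlt
  rcases eq_or_ne b 0 with rfl | hb
  · have := h 2 _root_.one_lt_two
    rw [mul_zero] at this
    exact absurd hlt (not_lt.2 this)
  have hbtop : b ≠ ∞ := hlt.ne_top
  have h1 : 1 < a / b := by
    rwa [ENNReal.lt_div_iff_mul_lt (Or.inl hb) (Or.inl hbtop), one_mul]
  obtain ⟨N, hN1, hN⟩ := ENNReal.lt_iff_exists_nnreal_btwn.1 h1
  rw [ENNReal.lt_div_iff_mul_lt (Or.inl hb) (Or.inl hbtop)] at hN
  exact absurd (h N (by exact_mod_cast hN1)) (not_le.2 hN)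

theorem IsStandardProfile.uniformMajorant_le (hΦ : IsStandardProfile n Φ) (hn : 1 ≤ n) {k : ℕ}
    {t : ℝ} (ht : 0 < t) {c : ℝ≥0∞}
    (hbound : ∀ f : EuclideanSpace ℝ (Fin n) → ℂ, E.Mem f →
      modulus k (potential Φ f) (t ^ (1 / (n : ℝ))) ≤ c * ∫⁻ τ in Ioo 0 T,
        ENNReal.ofReal (OmegaPhi n k Φ t τ) * rearr volume (fun x => ‖f x‖ₑ) τ) :
    uniformMajorant k E Φ (t ^ (1 / (n : ℝ))) ≤ c * E.assocNormOn T (OmegaPhi n k Φ t) := by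
  refine iSup_le fun u => iSup_le fun _ => iSup_le fun hnorm => ?_
  refine ENNReal.le_of_forall_one_lt_le_mul fun N hN => ?_
  have hlt : potentialNorm E Φ u < N := hnorm.trans_lt (by exact_mod_cast hN)
  simp only [potentialNorm, iInf_lt_iff] at hlt
  obtain ⟨f, hf, rfl, hfN⟩ := hlt
  rw [mul_left_comm]
  refine (hbound f hf).trans ?_
  gcongr
  exact setLIntegral_mul_rearr_le_assocNormOn hn
    ((hΦ.antitoneOn_OmegaPhi k ht).mono Ioo_subset_Ioi_self)
    ((hΦ.continuousOn_OmegaPhi k ht).mono Ioo_subset_Ioi_self) hf.1.enorm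
    (zero_lt_one.trans hN).ne' hfN.le

/-- Each competitor `h` in the associate norm enters only through `h^*`; take `σ = h^*`, whose
restriction to `(0, T)` still has norm at most `1`. -/
theorem IsStandardProfile.le_uniformMajorant (hΦ : IsStandardProfile n Φ) (hn : 1 ≤ n) {k : ℕ}
    {t : ℝ} (ht : 0 < t) {c : ℝ≥0∞}
    (hbound : ∀ σ : ℝ → ℝ≥0∞, AntitoneOn σ (Ioo 0 T) → E.luxNormOn T σ < ∞ →
      ∃ f : EuclideanSpace ℝ (Fin n) → ℂ, AEMeasurable f volume ∧
        E.rho (fun x => ‖f x‖ₑ) ≤ E.luxNormOn T σ ∧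
        c * ∫⁻ τ in Ioo 0 T, ENNReal.ofReal (OmegaPhi n k Φ t τ) * σ τ ≤
          modulus k (potential Φ f) (t ^ (1 / (n : ℝ)))) :
    c * E.assocNormOn T (OmegaPhi n k Φ t) ≤ uniformMajorant k E Φ (t ^ (1 / (n : ℝ))) := by
  unfold RISpace.assocNormOn RISpace.assocNorm
  simp only [ENNReal.mul_iSup]
  refine iSup_le fun h => iSup_le fun hm => iSup_le fun hnorm => ?_
  have hanti : AntitoneOn (rearr volPos h) (Ioo 0 T) := (rearr_antitone h).antitoneOn _
  have hlux : E.luxNormOn T (rearr volPos h) ≤ 1 := by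
    refine (luxNorm_mono (fun t ht => ?_) hn).trans hnorm
    rw [← rearr_volPos_rearr h]
    exact rearr_mono_ae (Filter.Eventually.of_forall fun τ => by
      rw [rearr_volPos_rearr]
      exact indicator_le_self (Ioo 0 T) (rearr volPos h) τ) t
  obtain ⟨f, hf, hrho, hmod⟩ := hbound _ hanti (hlux.trans_lt ENNReal.one_lt_top)
  rw [← setLIntegral_ofReal_mul_eq ((hΦ.antitoneOn_OmegaPhi k ht).mono Ioo_subset_Ioi_self)
    ((hΦ.continuousOn_OmegaPhi k ht).mono Ioo_subset_Ioi_self)]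
  refine hmod.trans ?_
  have hmem : E.Mem f := ⟨hf, (hrho.trans hlux).trans_lt ENNReal.one_lt_top⟩
  have hnorm : potentialNorm E Φ (potential Φ f) ≤ 1 := by
    unfold potentialNorm
    exact iInf_le_of_le f (iInf_le_of_le hmem (iInf_le_of_le rfl (hrho.trans hlux)))
  exact le_iSup_of_le (potential Φ f)
    (le_iSup_of_le ⟨f, hmem, rfl⟩ (le_iSup_of_le hnorm le_rfl))

end Majorant

/-! ### Choice of the constants and assembly. -/

theorem theorem2p2 :
    ∃ (c₁ : ℕ → ℕ → ℝ → ℝ → ℝ → ℝ → ℝ → ℝ) (c₂ : ℕ → ℕ → ℝ → ℝ → ℝ → ℝ → ℝ),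
    ∀ (k n : ℕ) (z₁ a₁ a₂ T : ℝ), 1 ≤ k → 1 ≤ n → 0 < z₁ → 0 < a₁ → 0 < a₂ → 0 < T →
    ∀ (E : RISpace (volume : Measure (EuclideanSpace ℝ (Fin n)))) (Φ : ℝ → ℝ),
      IsStandardProfile n Φ → E.assocNormOn T (phi n Φ) < ∞ → DerivUpperBounds k Φ z₁ a₁ a₂ →
      -- Part 1
      (0 < c₁ k n z₁ a₁ a₂ T (tailConst n Φ T) ∧
        (∀ f : EuclideanSpace ℝ (Fin n) → ℂ, E.Mem f → ∀ t ∈ Ioo 0 T,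
          modulus k (potential Φ f) (t ^ (1 / (n : ℝ))) ≤
            ENNReal.ofReal (c₁ k n z₁ a₁ a₂ T (tailConst n Φ T)) *
              ∫⁻ τ in Ioo 0 T, ENNReal.ofReal (OmegaPhi n k Φ t τ) *
                rearr volume (fun x => ‖f x‖ₑ) τ) ∧
        (∀ t ∈ Ioo 0 T,
          uniformMajorant k E Φ (t ^ (1 / (n : ℝ))) ≤
            ENNReal.ofReal (c₁ k n z₁ a₁ a₂ T (tailConst n Φ T)) *
              E.assocNormOn T (OmegaPhi n k Φ t))) ∧
      -- Part 2
      (∀ δ₁ : ℝ, 0 < δ₁ → DerivLowerBound k Φ z₁ δ₁ →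
        0 < c₂ k n z₁ a₁ δ₁ T ∧
        (∀ σ : ℝ → ℝ≥0∞, AntitoneOn σ (Ioo 0 T) → E.luxNormOn T σ < ∞ →
          ∃ f : EuclideanSpace ℝ (Fin n) → ℂ, E.Mem f ∧
            (∀ τ : ℝ, 0 < τ → rearr volume (fun x => ‖f x‖ₑ) τ ≤ (Ioo 0 T).indicator σ τ) ∧
            ∀ t ∈ Ioo 0 T,
              ENNReal.ofReal (c₂ k n z₁ a₁ δ₁ T) *
                  ∫⁻ τ in Ioo 0 T, ENNReal.ofReal (OmegaPhi n k Φ t τ) * σ τ ≤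
                modulus k (potential Φ f) (t ^ (1 / (n : ℝ)))) ∧
        (∀ t ∈ Ioo 0 T,
          uniformMajorant k E Φ (t ^ (1 / (n : ℝ))) ≤
            ENNReal.ofReal (c₁ k n z₁ a₁ a₂ T (tailConst n Φ T)) *
              E.assocNormOn T (OmegaPhi n k Φ t)) ∧
        (∀ t ∈ Ioo 0 T,
          ENNReal.ofReal (c₂ k n z₁ a₁ δ₁ T) * E.assocNormOn T (OmegaPhi n k Φ t) ≤
            uniformMajorant k E Φ (t ^ (1 / (n : ℝ))))) := by

  -- The constants must be total functions of the parameters, chosen before `E` and `Φ`. The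
  -- positivity conditions are therefore moved behind the existential quantifier, with the default
  -- `0` where they fail.
  have hup : ∀ (k n : ℕ) (a₁ a₂ T : ℝ), ∃ C : ℝ, 1 ≤ k → 1 ≤ n → 0 < a₁ → 0 < a₂ → 0 < T →
      0 < C ∧ ∀ (z₁ : ℝ) (Φ : ℝ → ℝ), IsStandardProfile n Φ → DerivUpperBounds k Φ z₁ a₁ a₂ →
      ∀ f : EuclideanSpace ℝ (Fin n) → ℂ, AEMeasurable f volume → ∀ t ∈ Ioo 0 T,
        modulus k (potential Φ f) (t ^ (1 / (n : ℝ))) ≤ ENNReal.ofReal (C * tailConst n Φ T) *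
          ∫⁻ τ in Ioo 0 T, ENNReal.ofReal (OmegaPhi n k Φ t τ) *
            rearr volume (fun x => ‖f x‖ₑ) τ := by
    intro k n a₁ a₂ T
    by_cases h : 1 ≤ k ∧ 1 ≤ n ∧ 0 < a₁ ∧ 0 < a₂ ∧ 0 < T
    · obtain ⟨hk, hn, h₁, h₂, hT⟩ := h
      obtain ⟨C, hC⟩ := exists_modulus_le k n hk hn h₁ h₂ hT
      exact ⟨C, fun _ _ _ _ _ => hC⟩
    · exact ⟨0, fun hk hn h₁ h₂ hT => absurd ⟨hk, hn, h₁, h₂, hT⟩ h⟩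
  have hlo : ∀ (k n : ℕ) (z₁ a₁ δ₁ T : ℝ), ∃ c : ℝ, 1 ≤ k → 1 ≤ n → 0 < z₁ → 0 < δ₁ → 0 < T →
      0 < c ∧ ∀ (a₂ : ℝ)
      (E : RISpace (volume : Measure (EuclideanSpace ℝ (Fin n)))) (Φ : ℝ → ℝ),
      IsStandardProfile n Φ → E.assocNormOn T (phi n Φ) < ∞ → DerivUpperBounds k Φ z₁ a₁ a₂ →
      DerivLowerBound k Φ z₁ δ₁ →
      ∀ σ : ℝ → ℝ≥0∞, AntitoneOn σ (Ioo 0 T) → E.luxNormOn T σ < ∞ →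
        ∃ f : EuclideanSpace ℝ (Fin n) → ℂ, AEMeasurable f volume ∧
          E.rho (fun x => ‖f x‖ₑ) ≤ E.luxNormOn T σ ∧
          (∀ τ : ℝ, 0 < τ → rearr volume (fun x => ‖f x‖ₑ) τ ≤ (Ioo 0 T).indicator σ τ) ∧
          ∀ t ∈ Ioo 0 T, ENNReal.ofReal c *
            ∫⁻ τ in Ioo 0 T, ENNReal.ofReal (OmegaPhi n k Φ t τ) * σ τ ≤
              modulus k (potential Φ f) (t ^ (1 / (n : ℝ))) := by
    intro k n z₁ a₁ δ₁ T
    by_cases h : 1 ≤ k ∧ 1 ≤ n ∧ 0 < z₁ ∧ 0 < δ₁ ∧ 0 < T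
    · obtain ⟨hk, hn, hz, hδ, hT⟩ := h
      obtain ⟨c, hc⟩ := exists_le_modulus k n hk hn (a₁ := a₁) hz hδ hT
      exact ⟨c, fun _ _ _ _ _ => hc⟩
    · exact ⟨0, fun hk hn hz hδ hT => absurd ⟨hk, hn, hz, hδ, hT⟩ h⟩
  choose C hC using hup
  choose c hc using hlo
  refine ⟨fun k n _ a₁ a₂ T c₀ => C k n a₁ a₂ T * c₀, c,
    fun k n z₁ a₁ a₂ T hk hn hz h₁ h₂ hT E Φ hΦ hfin hd => ?_⟩
  obtain ⟨hCpos, hCbound⟩ := hC k n a₁ a₂ T hk hn h₁ h₂ hT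
  have hmaj : ∀ t ∈ Ioo 0 T, uniformMajorant k E Φ (t ^ (1 / (n : ℝ))) ≤
      ENNReal.ofReal (C k n a₁ a₂ T * tailConst n Φ T) * E.assocNormOn T (OmegaPhi n k Φ t) :=
    fun t ht => hΦ.uniformMajorant_le hn ht.1 fun f hf => hCbound z₁ Φ hΦ hd f hf.1 t ht
  refine ⟨⟨mul_pos hCpos (zero_lt_one.trans_le (hΦ.one_le_tailConst hn hT)),
    fun f hf t ht => hCbound z₁ Φ hΦ hd f hf.1 t ht, hmaj⟩, fun δ₁ hδ hl => ?_⟩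
  obtain ⟨hcpos, hcbound⟩ := hc k n z₁ a₁ δ₁ T hk hn hz hδ hT
  refine ⟨hcpos, fun σ hσ hσE => ?_, hmaj, fun t ht => ?_⟩
  · obtain ⟨f, hf, hrho, hre, hmod⟩ := hcbound a₂ E Φ hΦ hfin hd hl σ hσ hσE
    exact ⟨f, ⟨hf, hrho.trans_lt hσE⟩, hre, hmod⟩
  · refine hΦ.le_uniformMajorant hn ht.1 fun σ hσ hσE => ?_
    obtain ⟨f, hf, hrho, -, hmod⟩ := hcbound a₂ E Φ hΦ hfin hd hl σ hσ hσE
    exact ⟨f, hf, hrho, hmod t ht⟩
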